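/- Let $d\ge 1$, $r\ge 1$. Let $p_0$ be a probability density on $\mathbb R^d$ with Fourier transform $\widehat{p_0}(s)=\int_{\mathbb R^d}e^{-\mathrm i s^\top x}p_0(x)\,dx$, and let $\mathcal X\subseteq\mathbb R^d$ be a set that is contained in the closure of its interior and on which the derivative of a differentiable function is unique (for example an open set, such as $\mathbb R^d$, or a convex set with nonempty interior). Assume $p_0\in\mathcal C^r(\mathcal X)$, that is, on $\mathcal X$ all partial derivatives of $p_0$ up to order $r$ exist and are continuous, bounded and integrable. Let $X_1,\dots,X_n$ ($n\ge1$) be i.i.d. with density $p_0$, and for $R>0$ let $$\widehat f_{n,R}(x)=\frac1{n\pi^d}\sum_{k=1}^n\prod_{j=1}^d\frac{\sin(R(x_j-X_{kj}))}{x_j-X_{kj}}$$ (with $\sin(Rt)/t:=R$ at $t=0$) be the Fourier density estimator. For an $i$-times differentiable $f$ let $\nabla^i f(x)$ be the array of all partial derivatives $\partial^i f/\partial x_{u_1}\cdots\partial x_{u_i}$, $1\le u_1,\dots,u_i\le d$; $\|\cdot\|_{\max}$ is the largest absolute value of an entry, $\|\cdot\|$ the Euclidean norm of the array, and expectations of arrays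 are taken entrywise. Then all entries of $\nabla^i\widehat f_{n,R}(x)$ below are square integrable, and the following holds. (a) Suppose that $p_0$ is upper-supersmooth of order $\alpha>0$ with constants $C$ and $C_1>0$: $|\widehat{p_0}(s)|\le C\exp\big(-C_1\sum_{j=1}^d|s_j|^\alpha\big)$ for all $s\in\mathbb R^d$. Then there are constants $C'>0$, $C_1',\dots,C_r'$ and $\bar C_1,\dots,\bar C_r$, depending only on $d,r,\alpha,C,C_1$, such that for all $R\ge C'$, all $n\ge1$ and all $1\le i\le r$, $$\sup_{x\in\mathcal X}\big\|\mathbb E[\nabla^i\widehat f_{n,R}(x)]-\nabla^i p_0(x)\big\|_{\max}\le C_i'\,R^{\max\{1+i-\alpha,0\}}\exp(-C_1R^\alpha),$$ $$\sup_{x\in\mathcal X}\mathbb E\Big[\big\|\nabla^i\widehat f_{n,R}(x)-\mathbb E[\nabla^i\widehat f_{n,R}(x)]\big\|^2\Big]\le\bar C_i\,\frac{R^{2i+d}}{n}.$$ (b) Suppose that $p_0$ is upper-ordinary smooth of order $\beta>1+r$ with constant $c$: $|\widehat{p_0}(s)|\le c\prod_{j=1}^d\frac1{1+|s_j|^\beta}$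 for all $s\in\mathbb R^d$. Then there are constants $c_1,\dots,c_r$ and $\bar C_1,\dots,\bar C_r$, depending only on $d,r,\beta,c$, such that for all $R>0$, all $n\ge1$ and all $1\le i\le r$, $$\sup_{x\in\mathcal X}\big\|\mathbb E[\nabla^i\widehat f_{n,R}(x)]-\nabla^i p_0(x)\big\|_{\max}\le\frac{c_i}{R^{\beta-(i+1)}},$$ $$\sup_{x\in\mathcal X}\mathbb E\Big[\big\|\nabla^i\widehat f_{n,R}(x)-\mathbb E[\nabla^i\widehat f_{n,R}(x)]\big\|^2\Big]\le\bar C_i\,\frac{R^{2i+d}}{n}.$$ -/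

import Mathlib

open MeasureTheory ProbabilityTheory

noncomputable section

/-- The Fourier transform with angular frequency, `s ↦ ∫ exp(-i s·x) p(x) dx`. -/
def angularFourier {d : ℕ} (p : EuclideanSpace ℝ (Fin d) → ℝ)
    (s : EuclideanSpace ℝ (Fin d)) : ℂ :=
  ∫ x : EuclideanSpace ℝ (Fin d),
    Complex.exp (-Complex.I * ((∑ j, s j * x j : ℝ) : ℂ)) * ((p x : ℝ) : ℂ)

/-- `p` is a probability density on `ℝ^d` with respect to Lebesgue measure. -/
structure IsProbDensity {d : ℕ} (p : EuclideanSpace ℝ (Fin d) → ℝ) : Prop where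
  nonneg : ∀ x, 0 ≤ p x
  integrable : Integrable p
  integral_eq_one : ∫ x, p x = 1

/-- `p` is upper-supersmooth of order `α`, with associated constants `C` and `C₁`. -/
def UpperSupersmooth {d : ℕ} (p : EuclideanSpace ℝ (Fin d) → ℝ) (α C C₁ : ℝ) : Prop :=
  ∀ s : EuclideanSpace ℝ (Fin d),
    ‖angularFourier p s‖ ≤ C * Real.exp (-C₁ * ∑ j, |s j| ^ α)

/-- `p` is upper-ordinary smooth of order `β`, with associated constant `c`. -/
def UpperOrdinarySmooth {d : ℕ} (p : EuclideanSpace ℝ (Fin d) → ℝ) (β c : ℝ) : Prop :=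
  ∀ s : EuclideanSpace ℝ (Fin d),
    ‖angularFourier p s‖ ≤ c * ∏ j, 1 / (1 + |s j| ^ β)

/-- The array of all partial derivatives of order `i` of `f` at `x`, where `f` is considered
as a function on `S`: its entry `u` is `∂^i f / ∂x_{u_1} ⋯ ∂x_{u_i}`. -/
def derivArray {d : ℕ} (i : ℕ) (f : EuclideanSpace ℝ (Fin d) → ℝ)
    (S : Set (EuclideanSpace ℝ (Fin d))) (x : EuclideanSpace ℝ (Fin d)) :
    (Fin i → Fin d) → ℝ :=
  fun u => iteratedFDerivWithin ℝ i f S x (fun k => EuclideanSpace.single (u k) (1 : ℝ))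

/-- The class `C^r(S)`: functions with continuous, bounded and integrable partial derivatives
on `S` up to order `r`. -/
structure MemCr {d : ℕ} (r : ℕ) (S : Set (EuclideanSpace ℝ (Fin d)))
    (f : EuclideanSpace ℝ (Fin d) → ℝ) : Prop where
  contDiffOn : ContDiffOn ℝ (r : WithTop ℕ∞) f S
  bounded : ∀ k ≤ r, ∀ u : Fin k → Fin d, ∃ M : ℝ, ∀ x ∈ S, |derivArray k f S x u| ≤ M
  integrable : ∀ k ≤ r, ∀ u : Fin k → Fin d, IntegrableOn (fun x => derivArray k f S x u) S

/-- A subset of `ℝ^d` on which derivatives up to the boundary make sense: each point is a limit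
of interior points, and the derivative of a function on `S` is unique. Open sets and convex sets
with nonempty interior are examples. -/
structure IsRegularDomain {d : ℕ} (S : Set (EuclideanSpace ℝ (Fin d))) : Prop where
  subset_closure_interior : S ⊆ closure (interior S)
  uniqueDiffOn : UniqueDiffOn ℝ S

/-- The function `t ↦ sin(R t) / t`, with its continuous value `R` at `t = 0`. -/
def sinKernel (R t : ℝ) : ℝ := if t = 0 then R else Real.sin (R * t) / t

/-- The Fourier density estimator with radius `R` built from the data `X_1, …, X_n`. -/
def fourierEstimator {d n : ℕ} (R : ℝ) (X : Fin n → EuclideanSpace ℝ (Fin d))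
    (x : EuclideanSpace ℝ (Fin d)) : ℝ :=
  1 / (n * Real.pi ^ d) * ∑ k, ∏ j, sinKernel R (x j - X k j)

/-- `X_1, …, X_n` are independent random vectors, each with density `p`. -/
structure IsIIDSample {Ω : Type*} [MeasurableSpace Ω] {d n : ℕ} (P : Measure Ω)
    (X : Fin n → Ω → EuclideanSpace ℝ (Fin d)) (p : EuclideanSpace ℝ (Fin d) → ℝ) : Prop where
  measurable : ∀ k, Measurable (X k)
  indep : iIndepFun X P
  law : ∀ k, P.map (X k) = volume.withDensity (fun x => ENNReal.ofReal (p x))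

/-- The array `∇^i f̂(x)` of derivatives of the estimator, as a random array. -/
def estimatorDeriv {Ω : Type*} {d n : ℕ} (R : ℝ) (X : Fin n → Ω → EuclideanSpace ℝ (Fin d))
    (i : ℕ) (x : EuclideanSpace ℝ (Fin d)) (ω : Ω) : (Fin i → Fin d) → ℝ :=
  derivArray i (fourierEstimator R (fun k => X k ω)) Set.univ x

/-- The (entrywise) expectation `E[∇^i f̂(x)]`. -/
def meanDeriv {Ω : Type*} [MeasurableSpace Ω] {d n : ℕ} (P : Measure Ω) (R : ℝ)
    (X : Fin n → Ω → EuclideanSpace ℝ (Fin d)) (i : ℕ) (x : EuclideanSpace ℝ (Fin d)) :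
    (Fin i → Fin d) → ℝ :=
  fun u => ∫ ω, estimatorDeriv R X i x ω u ∂P

/-- `‖E[∇^i f̂(x)] - ∇^i p(x)‖_max`, the largest absolute value of an entry;
the norm on the finite product `(Fin i → Fin d) → ℝ` is this maximum. -/
def maxBias {Ω : Type*} [MeasurableSpace Ω] {d n : ℕ} (P : Measure Ω) (R : ℝ)
    (X : Fin n → Ω → EuclideanSpace ℝ (Fin d)) (p : EuclideanSpace ℝ (Fin d) → ℝ)
    (S : Set (EuclideanSpace ℝ (Fin d))) (i : ℕ) (x : EuclideanSpace ℝ (Fin d)) : ℝ :=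
  ‖meanDeriv P R X i x - derivArray i p S x‖

/-- `E[‖∇^i f̂(x) - E[∇^i f̂(x)]‖²]`, with the Euclidean norm of an array. -/
def derivVariance {Ω : Type*} [MeasurableSpace Ω] {d n : ℕ} (P : Measure Ω) (R : ℝ)
    (X : Fin n → Ω → EuclideanSpace ℝ (Fin d)) (i : ℕ) (x : EuclideanSpace ℝ (Fin d)) : ℝ :=
  ∫ ω, ∑ u, (estimatorDeriv R X i x ω u - meanDeriv P R X i x u) ^ 2 ∂P

end

/-! The kernel `∏ⱼ sin(R yⱼ) / (π yⱼ)` is `(2π)⁻ᵈ` times the Fourier integral of the indicator of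
the cube `[-R, R]ᵈ`. Differentiation multiplies the amplitude by `∏ₖ i s_{uₖ}`, and expectation
multiplies it by the Fourier transform of `p`. The mean of the differentiated estimator is therefore
the Fourier inversion integral of the same derivative of `p`, cut off at the cube
(`IsIIDSample.meanDeriv_eq`, `derivArray_density`).

Bias: what remains is an integral over the complement of the cube. If the transform is dominated by
`c ∏ⱼ φ(sⱼ)`, the integrand is dominated by a product of `w(t) = (1 + |t|)ⁱ φ(t)`. Outside the cube
some coordinate exceeds `R`, so a union bound and Fubini leave a one-dimensional tail of `w`
(`integral_compl_freqBox_prod_le`).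

Variance: independence gives `1/n` times the second moment of one kernel. By Parseval this moment
pairs the amplitude `G` with a convolution of its conjugate and the transform of `p`, hence is at
most `‖G‖₁ ‖G‖_∞` times the `L¹` norm of that transform (`integral_norm_waveIntegral_sq_mul_le`). On
the cube `‖G‖_∞ ≤ Rⁱ` and `‖G‖₁ ≤ (2R)ᵈ Rⁱ`, which gives `R^(2i+d)`. The `L¹` norm is bounded
through `φ` alone, so no constant depends on `p` or the domain.

`estimator_bounds` combines both for a general `φ`; the two smoothness classes differ only in their
integrability and tail estimates. -/

/-- The plane wave `exp(i s·y)`. -/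
noncomputable def planeWave {d : ℕ} (s y : EuclideanSpace ℝ (Fin d)) : ℂ :=
  Complex.exp (Complex.I * ((∑ j, s j * y j : ℝ) : ℂ))

/-- The superposition `∫ exp(i s·y) g(s) ds` of plane waves with amplitudes `g`. -/
noncomputable def waveIntegral {d : ℕ} (g : EuclideanSpace ℝ (Fin d) → ℂ)
    (y : EuclideanSpace ℝ (Fin d)) : ℂ :=
  ∫ s, planeWave s y * g s

/-- The pairing for which the vector-valued Fourier integral is `waveIntegral`. -/
noncomputable def angularPairing (d : ℕ) :
    EuclideanSpace ℝ (Fin d) →L[ℝ] EuclideanSpace ℝ (Fin d) →L[ℝ] ℝ :=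
  (-(2 * Real.pi)⁻¹) • innerSL ℝ

/-- The Fourier symbol `∏ₖ i s_{uₖ}` of a partial derivative. -/
noncomputable def derivSymbol {d i : ℕ} (u : Fin i → Fin d) (s : EuclideanSpace ℝ (Fin d)) : ℂ :=
  ∏ k, (Complex.I * ((s (u k) : ℝ) : ℂ))

/-! ### Plane waves, wave integrals and their derivatives -/

section PlaneWave

variable {d : ℕ}

lemma angularPairing_apply (s y : EuclideanSpace ℝ (Fin d)) :
    angularPairing d s y = -(2 * Real.pi)⁻¹ * ∑ j, s j * y j := by
  have h : innerSL ℝ s y = ∑ j, s j * y j := by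
    rw [innerSL_apply_apply, PiLp.inner_apply]
    simp [mul_comm]
  rw [angularPairing, ← h]
  rfl

lemma norm_planeWave (s y : EuclideanSpace ℝ (Fin d)) : ‖planeWave s y‖ = 1 := by
  rw [planeWave, mul_comm, Complex.norm_exp_ofReal_mul_I]

lemma planeWave_add_right (s y z : EuclideanSpace ℝ (Fin d)) :
    planeWave s (y + z) = planeWave s y * planeWave s z := by
  rw [planeWave, planeWave, planeWave, ← Complex.exp_add]
  simp [mul_add, Finset.sum_add_distrib]

lemma planeWave_comm (s y : EuclideanSpace ℝ (Fin d)) : planeWave s y = planeWave y s := by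
  simp [planeWave, mul_comm]

lemma planeWave_neg_neg (s y : EuclideanSpace ℝ (Fin d)) :
    planeWave (-s) (-y) = planeWave s y := by
  simp [planeWave]

lemma conj_planeWave (s y : EuclideanSpace ℝ (Fin d)) :
    (starRingEnd ℂ) (planeWave s y) = planeWave (-s) y := by
  rw [planeWave, planeWave, ← Complex.exp_conj]
  simp

lemma continuous_planeWave :
    Continuous fun q : EuclideanSpace ℝ (Fin d) × EuclideanSpace ℝ (Fin d) =>
      planeWave q.1 q.2 := by
  unfold planeWave
  fun_prop

lemma continuous_planeWave_left (y : EuclideanSpace ℝ (Fin d)) :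
    Continuous fun s => planeWave s y :=
  continuous_planeWave.comp (continuous_id.prodMk continuous_const)

lemma planeWave_eq_prod (s y : EuclideanSpace ℝ (Fin d)) :
    planeWave s y = ∏ j, Complex.exp (Complex.I * ((s j * y j : ℝ) : ℂ)) := by
  rw [planeWave, ← Complex.exp_sum, Complex.ofReal_sum, Finset.mul_sum]

lemma continuous_derivSymbol {i : ℕ} (u : Fin i → Fin d) : Continuous (derivSymbol u) := by
  unfold derivSymbol
  fun_prop

/-- The factor `-(2π)⁻¹` of `angularPairing` cancels the `-2π` built into the Fourier character.
Continuity, self-adjointness and differentiation under the integral all come through this identity.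
-/
lemma waveIntegral_eq_fourierIntegral (g : EuclideanSpace ℝ (Fin d) → ℂ) :
    waveIntegral g = VectorFourier.fourierIntegral Real.fourierChar volume
      (angularPairing d).toLinearMap₁₂ g := by
  ext y
  rw [waveIntegral, VectorFourier.fourierIntegral]
  congr 1
  ext s
  rw [Circle.smul_def, Real.fourierChar_apply, smul_eq_mul, planeWave]
  congr 2
  have h : (2 * Real.pi * -(angularPairing d).toLinearMap₁₂ s y : ℝ) = ∑ j, s j * y j := by
    rw [show (angularPairing d).toLinearMap₁₂ s y = angularPairing d s y from rfl,
      angularPairing_apply]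
    field_simp
  rw [h, mul_comm]

lemma angularFourier_eq_waveIntegral (p : EuclideanSpace ℝ (Fin d) → ℝ)
    (s : EuclideanSpace ℝ (Fin d)) :
    angularFourier p s = waveIntegral (fun x => (p x : ℂ)) (-s) := by
  rw [angularFourier, waveIntegral]
  congr 1
  ext x
  congr 1
  rw [planeWave_comm, planeWave]
  simp

lemma integrable_planeWave_mul {g : EuclideanSpace ℝ (Fin d) → ℂ} (hg : Integrable g)
    (y : EuclideanSpace ℝ (Fin d)) : Integrable fun s => planeWave s y * g s :=
  hg.bdd_mul (c := 1) (continuous_planeWave_left y).aestronglyMeasurable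
    (Filter.Eventually.of_forall fun s => (norm_planeWave s y).le)

lemma continuous_waveIntegral {g : EuclideanSpace ℝ (Fin d) → ℂ} (hg : Integrable g) :
    Continuous (waveIntegral g) := by
  rw [waveIntegral_eq_fourierIntegral]
  exact VectorFourier.fourierIntegral_continuous Real.continuous_fourierChar
    (angularPairing d).continuous₂ hg

lemma norm_waveIntegral_le (g : EuclideanSpace ℝ (Fin d) → ℂ) (y : EuclideanSpace ℝ (Fin d)) :
    ‖waveIntegral g y‖ ≤ ∫ s, ‖g s‖ := by
  refine (norm_integral_le_integral_norm _).trans (le_of_eq ?_)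
  simp [norm_planeWave]

/-- The wave integral is symmetric. -/
lemma integral_waveIntegral_mul {g h : EuclideanSpace ℝ (Fin d) → ℂ} (hg : Integrable g)
    (hh : Integrable h) :
    ∫ z, waveIntegral g z * h z = ∫ s, g s * waveIntegral h s := by
  -- The pairing is symmetric, so the transform is its own transpose.
  have hflip : (angularPairing d).toLinearMap₁₂.flip = (angularPairing d).toLinearMap₁₂ := by
    ext s y
    change angularPairing d _ _ = angularPairing d _ _
    simp [angularPairing_apply, mul_comm]
  have := VectorFourier.integral_fourierIntegral_smul_eq_flip (μ := volume) (ν := volume)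
    (L := (angularPairing d).toLinearMap₁₂) Real.continuous_fourierChar
    (angularPairing d).continuous₂ hg hh
  rw [hflip] at this
  simpa only [waveIntegral_eq_fourierIntegral, smul_eq_mul] using this

lemma contDiff_waveIntegral {g : EuclideanSpace ℝ (Fin d) → ℂ} {N : ℕ}
    (hg : ∀ k ≤ N, Integrable fun s => ‖s‖ ^ k * ‖g s‖) : ContDiff ℝ N (waveIntegral g) := by
  rw [waveIntegral_eq_fourierIntegral]
  exact_mod_cast VectorFourier.contDiff_fourierIntegral (N := N) (angularPairing d)
    (fun k hk => hg k (by exact_mod_cast hk))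

lemma iteratedFDeriv_waveIntegral_single {g : EuclideanSpace ℝ (Fin d) → ℂ} {N : ℕ}
    (hg : ∀ k ≤ N, Integrable fun s => ‖s‖ ^ k * ‖g s‖) (hgm : AEStronglyMeasurable g)
    {i : ℕ} (hi : i ≤ N) (u : Fin i → Fin d) (y : EuclideanSpace ℝ (Fin d)) :
    iteratedFDeriv ℝ i (waveIntegral g) y (fun k => EuclideanSpace.single (u k) (1 : ℝ)) =
      waveIntegral (fun s => derivSymbol u s * g s) y := by
  have hg' : ∀ k : ℕ, (k : ℕ∞) ≤ (N : ℕ∞) → Integrable fun s => ‖s‖ ^ k * ‖g s‖ :=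
    fun k hk => hg k (by exact_mod_cast hk)
  have hint : Integrable fun s => VectorFourier.fourierPowSMulRight (angularPairing d) g s i :=
    VectorFourier.integrable_fourierPowSMulRight (angularPairing d) (hg i hi) hgm
  rw [waveIntegral_eq_fourierIntegral, VectorFourier.iteratedFDeriv_fourierIntegral
    (angularPairing d) hg' hgm (by exact_mod_cast hi),
    Real.fourierIntegral_continuousMultilinearMap_apply' hint, waveIntegral_eq_fourierIntegral]
  congr 1
  ext s
  rw [VectorFourier.fourierPowSMulRight_apply]
  simp only [angularPairing_apply, PiLp.single_apply, mul_ite, mul_one, mul_zero,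
    Finset.sum_ite_eq', Finset.mem_univ, if_true, derivSymbol]
  rw [Complex.real_smul, smul_eq_mul, ← mul_assoc]
  congr 1
  rw [Complex.ofReal_prod, Finset.prod_congr rfl fun k _ => Complex.ofReal_mul _ _]
  simp only [Finset.prod_mul_distrib, Finset.prod_const, Finset.card_univ, Fintype.card_fin]
  rw [← mul_assoc, ← mul_pow]
  congr 2
  push_cast
  field_simp

/-- Partial derivatives of a real part of a wave integral. -/
lemma derivArray_re_waveIntegral {g : EuclideanSpace ℝ (Fin d) → ℂ} {N : ℕ}
    (hg : ∀ k ≤ N, Integrable fun s => ‖s‖ ^ k * ‖g s‖) (hgm : AEStronglyMeasurable g)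
    {i : ℕ} (hi : i ≤ N) {S : Set (EuclideanSpace ℝ (Fin d))} (hS : UniqueDiffOn ℝ S)
    {y : EuclideanSpace ℝ (Fin d)} (hy : y ∈ S) (u : Fin i → Fin d) :
    derivArray i (fun y => (waveIntegral g y).re) S y u =
      (waveIntegral (fun s => derivSymbol u s * g s) y).re := by
  have hc : ContDiff ℝ i (waveIntegral g) :=
    (contDiff_waveIntegral hg).of_le (by exact_mod_cast hi)
  have hre : ContDiff ℝ i fun y => (waveIntegral g y).re := Complex.reCLM.contDiff.comp hc
  rw [derivArray, iteratedFDerivWithin_eq_iteratedFDeriv hS hre.contDiffAt hy,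
    show (fun y => (waveIntegral g y).re) = Complex.reCLM ∘ waveIntegral g from rfl,
    Complex.reCLM.iteratedFDeriv_comp_left hc.contDiffAt le_rfl,
    ContinuousLinearMap.compContinuousMultilinearMap_coe, Function.comp_apply,
    iteratedFDeriv_waveIntegral_single hg hgm hi, Complex.reCLM_apply]

end PlaneWave

/-! ### The frequency cube and the estimator as a band-limited wave integral -/

/-- The cube `[-R, R]^d` of frequencies. -/
def freqBox (d : ℕ) (R : ℝ) : Set (EuclideanSpace ℝ (Fin d)) :=
  {s | ∀ j, s j ∈ Set.Icc (-R) R}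

/-- The kernel `∂_u ∏ⱼ sin(R yⱼ) / (π yⱼ)`, as a complex function. -/
noncomputable def derivKernel {d i : ℕ} (R : ℝ) (u : Fin i → Fin d)
    (y : EuclideanSpace ℝ (Fin d)) : ℂ :=
  (((2 * Real.pi) ^ d)⁻¹ : ℝ) * waveIntegral ((freqBox d R).indicator (derivSymbol u)) y

section Box

variable {d : ℕ}

lemma integrable_prod_coord {f : Fin d → ℝ → ℂ} (hf : ∀ j, Integrable (f j)) :
    Integrable fun s : EuclideanSpace ℝ (Fin d) => ∏ j, f j (s j) := by
  rw [← (PiLp.volume_preserving_toLp (Fin d)).integrable_comp_emb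
    (MeasurableEquiv.toLp 2 _).measurableEmbedding]
  exact Integrable.fintype_prod hf

lemma integral_prod_coord (f : Fin d → ℝ → ℂ) :
    ∫ s : EuclideanSpace ℝ (Fin d), ∏ j, f j (s j) = ∏ j, ∫ t, f j t := by
  rw [← (PiLp.volume_preserving_toLp (Fin d)).integral_comp
    (MeasurableEquiv.toLp 2 _).measurableEmbedding]
  exact integral_fintype_prod_volume_eq_prod f

lemma integrable_prod_coord_real {f : Fin d → ℝ → ℝ} (hf : ∀ j, Integrable (f j)) :
    Integrable fun s : EuclideanSpace ℝ (Fin d) => ∏ j, f j (s j) := by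
  rw [← (PiLp.volume_preserving_toLp (Fin d)).integrable_comp_emb
    (MeasurableEquiv.toLp 2 _).measurableEmbedding]
  exact Integrable.fintype_prod hf

lemma integral_prod_coord_real (f : Fin d → ℝ → ℝ) :
    ∫ s : EuclideanSpace ℝ (Fin d), ∏ j, f j (s j) = ∏ j, ∫ t, f j t := by
  rw [← (PiLp.volume_preserving_toLp (Fin d)).integral_comp
    (MeasurableEquiv.toLp 2 _).measurableEmbedding]
  exact integral_fintype_prod_volume_eq_prod f

lemma isCompact_freqBox (R : ℝ) : IsCompact (freqBox d R) := by
  have h : freqBox d R = (EuclideanSpace.equiv (Fin d) ℝ).toHomeomorph ⁻¹'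
      Set.univ.pi fun _ => Set.Icc (-R) R := by
    ext s
    exact Set.mem_univ_pi.symm
  rw [h, Homeomorph.isCompact_preimage]
  exact isCompact_univ_pi fun _ => isCompact_Icc

lemma measurableSet_freqBox (R : ℝ) : MeasurableSet (freqBox d R) :=
  (isCompact_freqBox R).measurableSet

lemma integrable_indicator_freqBox {f : EuclideanSpace ℝ (Fin d) → ℂ} (hf : Continuous f)
    (R : ℝ) : Integrable ((freqBox d R).indicator f) :=
  (integrable_indicator_iff (measurableSet_freqBox R)).2
    (hf.continuousOn.integrableOn_compact (isCompact_freqBox R))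

lemma indicator_freqBox_eq_prod (R : ℝ) (s : EuclideanSpace ℝ (Fin d)) :
    (freqBox d R).indicator (fun _ => (1 : ℂ)) s =
      ∏ j, (Set.Icc (-R) R).indicator (fun _ => (1 : ℂ)) (s j) := by
  classical
  by_cases h : s ∈ freqBox d R
  · rw [Set.indicator_of_mem h, Finset.prod_congr rfl fun j _ => Set.indicator_of_mem (h j) _]
    simp
  · rw [Set.indicator_of_notMem h]
    obtain ⟨j, hj⟩ : ∃ j, s j ∉ Set.Icc (-R) R := by simpa [freqBox] using h
    exact (Finset.prod_eq_zero (Finset.mem_univ j) (Set.indicator_of_notMem hj _)).symm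

lemma integral_exp_eq_sinKernel {R : ℝ} (hR : 0 ≤ R) (y : ℝ) :
    ∫ t, Complex.exp (Complex.I * ((t * y : ℝ) : ℂ)) *
      (Set.Icc (-R) R).indicator (fun _ => (1 : ℂ)) t = 2 * (sinKernel R y : ℂ) := by
  have h1 : (fun t : ℝ => Complex.exp (Complex.I * ((t * y : ℝ) : ℂ)) *
      (Set.Icc (-R) R).indicator (fun _ => (1 : ℂ)) t) =
      (Set.Icc (-R) R).indicator fun t : ℝ => Complex.exp (Complex.I * y * t) := by
    ext t
    by_cases ht : t ∈ Set.Icc (-R) R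
    · simp only [Set.indicator_of_mem ht, mul_one]
      congr 1
      push_cast
      ring
    · simp only [Set.indicator_of_notMem ht, mul_zero]
  rw [h1, integral_indicator measurableSet_Icc, integral_Icc_eq_integral_Ioc,
    ← intervalIntegral.integral_of_le (by linarith)]
  -- At `y = 0` the integral is the length `2R`, which matches the value `R` assigned to `sinKernel`
  -- there.
  by_cases hy : y = 0
  · simp [hy, sinKernel]
    ring
  · have hc : Complex.I * (y : ℂ) ≠ 0 := by simp [hy]
    rw [integral_exp_mul_complex hc, sinKernel, if_neg hy]
    have hy' : (y : ℂ) ≠ 0 := by exact_mod_cast hy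
    push_cast
    rw [Complex.sin]
    field_simp
    rw [Complex.I_sq]
    ring_nf

lemma waveIntegral_indicator_freqBox {R : ℝ} (hR : 0 ≤ R) (y : EuclideanSpace ℝ (Fin d)) :
    waveIntegral ((freqBox d R).indicator fun _ => (1 : ℂ)) y =
      2 ^ d * ∏ j, (sinKernel R (y j) : ℂ) := by
  have h := integral_prod_coord (d := d) fun j t =>
    Complex.exp (Complex.I * ((t * y j : ℝ) : ℂ)) *
      (Set.Icc (-R) R).indicator (fun _ => (1 : ℂ)) t
  rw [Finset.prod_congr rfl fun j _ => integral_exp_eq_sinKernel hR (y j),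
    Finset.prod_mul_distrib] at h
  simp only [Finset.prod_const, Finset.card_univ, Fintype.card_fin] at h
  rw [← h, waveIntegral]
  congr 1
  ext s
  rw [Finset.prod_mul_distrib, planeWave_eq_prod, indicator_freqBox_eq_prod]

/-- The volume is the wave integral of the indicator at the origin, where every `sinKernel` equals
`R`. -/
lemma volume_real_freqBox {R : ℝ} (hR : 0 ≤ R) : volume.real (freqBox d R) = (2 * R) ^ d := by
  have h := waveIntegral_indicator_freqBox hR (0 : EuclideanSpace ℝ (Fin d))
  have h0 : waveIntegral ((freqBox d R).indicator fun _ => (1 : ℂ)) 0 =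
      (volume.real (freqBox d R) : ℂ) := by
    simp only [waveIntegral, planeWave, PiLp.zero_apply, mul_zero, Finset.sum_const_zero,
      Complex.ofReal_zero, Complex.exp_zero, one_mul]
    rw [integral_indicator (measurableSet_freqBox R), setIntegral_const]
    simp
  rw [h0] at h
  simp only [PiLp.zero_apply, sinKernel, if_true, Finset.prod_const, Finset.card_univ,
    Fintype.card_fin] at h
  rw [mul_pow]
  exact_mod_cast h

lemma norm_derivSymbol_le_of_mem_freqBox {i : ℕ} {R : ℝ} (u : Fin i → Fin d)
    {s : EuclideanSpace ℝ (Fin d)} (hs : s ∈ freqBox d R) : ‖derivSymbol u s‖ ≤ R ^ i := by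
  rw [derivSymbol, norm_prod]
  refine (Finset.prod_le_prod (g := fun _ => R) (fun k _ => norm_nonneg _)
    fun k _ => ?_).trans_eq (by simp)
  rw [norm_mul, Complex.norm_I, one_mul, Complex.norm_real]
  exact abs_le.2 (hs (u k))

/-- Each of the `i` factors is bounded by the whole product `∏ⱼ (1 + |sⱼ|)`. This loses some
sharpness but gives a bound independent of `u` and of product form, as Fubini requires. -/
lemma norm_derivSymbol_le {i : ℕ} (u : Fin i → Fin d) (s : EuclideanSpace ℝ (Fin d)) :
    ‖derivSymbol u s‖ ≤ ∏ j, (1 + |s j|) ^ i := by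
  rw [derivSymbol, norm_prod, Finset.prod_pow]
  refine (Finset.prod_le_prod (g := fun _ => ∏ j, (1 + |s j|))
    (fun k _ => norm_nonneg _) fun k _ => ?_).trans_eq (by simp)
  rw [norm_mul, Complex.norm_I, one_mul, Complex.norm_real, Real.norm_eq_abs]
  calc |s (u k)| ≤ 1 + |s (u k)| := by linarith
    _ ≤ ∏ j, (1 + |s j|) := by
      rw [← Finset.mul_prod_erase _ _ (Finset.mem_univ (u k))]
      refine le_mul_of_one_le_right (by positivity) ?_
      exact Finset.one_le_prod fun j _ => by simp

lemma norm_le_prod_one_add (s : EuclideanSpace ℝ (Fin d)) : ‖s‖ ≤ ∏ j, (1 + |s j|) := by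
  -- The extra `1` on the left makes the induction close: multiplying `1 + Σ` by `(1 + a)²` produces
  -- the new term `a²`.
  have hsum : ∀ A : Finset (Fin d), 1 + ∑ j ∈ A, |s j| ^ 2 ≤ ∏ j ∈ A, (1 + |s j|) ^ 2 := by
    intro A
    induction A using Finset.induction_on with
    | empty => simp
    | insert a A ha ih =>
      rw [Finset.sum_insert ha, Finset.prod_insert ha]
      have h0 : 0 ≤ ∑ j ∈ A, |s j| ^ 2 := Finset.sum_nonneg fun _ _ => sq_nonneg _
      have h1 : 0 ≤ |s a| := abs_nonneg _
      nlinarith [mul_le_mul_of_nonneg_left ih (sq_nonneg (1 + |s a|)),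
        mul_nonneg h1 h0, mul_nonneg (sq_nonneg |s a|) h0]
  rw [EuclideanSpace.norm_eq]
  refine Real.sqrt_le_iff.2 ⟨Finset.prod_nonneg fun j _ => by positivity, ?_⟩
  rw [← Finset.prod_pow]
  exact (le_add_of_nonneg_left zero_le_one).trans (hsum Finset.univ)

lemma norm_indicator_derivSymbol_le {i : ℕ} {R : ℝ} (u : Fin i → Fin d)
    (s : EuclideanSpace ℝ (Fin d)) :
    ‖(freqBox d R).indicator (derivSymbol u) s‖ ≤ (freqBox d R).indicator (fun _ => R ^ i) s := by
  by_cases h : s ∈ freqBox d R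
  · simpa [h] using norm_derivSymbol_le_of_mem_freqBox u h
  · simp [h]

lemma continuous_derivKernel {i : ℕ} (R : ℝ) (u : Fin i → Fin d) :
    Continuous (derivKernel R u) :=
  continuous_const.mul
    (continuous_waveIntegral (integrable_indicator_freqBox (continuous_derivSymbol u) R))

/-- A crude bound used only for integrability, so its dependence on `R` does not matter. -/
lemma exists_norm_derivKernel_le {i : ℕ} (R : ℝ) (u : Fin i → Fin d) :
    ∃ B, ∀ y, ‖derivKernel R u y‖ ≤ B := by
  refine ⟨‖((((2 * Real.pi) ^ d)⁻¹ : ℝ) : ℂ)‖ *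
    ∫ s, ‖(freqBox d R).indicator (derivSymbol u) s‖, fun y => ?_⟩
  rw [derivKernel, norm_mul]
  gcongr
  exact norm_waveIntegral_le _ y

/-- The estimator is the real part of a wave integral. -/
lemma fourierEstimator_eq {n : ℕ} {R : ℝ} (hR : 0 ≤ R)
    (X : Fin n → EuclideanSpace ℝ (Fin d)) (x : EuclideanSpace ℝ (Fin d)) :
    fourierEstimator R X x = (waveIntegral ((freqBox d R).indicator fun s =>
      ((n * (2 * Real.pi) ^ d : ℝ)⁻¹ : ℂ) * ∑ k, planeWave s (-X k)) x).re := by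
  have h : waveIntegral ((freqBox d R).indicator fun s =>
      ((n * (2 * Real.pi) ^ d : ℝ)⁻¹ : ℂ) * ∑ k, planeWave s (-X k)) x =
      ((n * (2 * Real.pi) ^ d : ℝ)⁻¹ : ℂ) *
        ∑ k, waveIntegral ((freqBox d R).indicator fun _ => (1 : ℂ)) (x - X k) := by
    have hbox : Integrable ((freqBox d R).indicator fun _ => (1 : ℂ)) :=
      integrable_indicator_freqBox continuous_const R
    simp only [waveIntegral]
    rw [← integral_finsetSum _ fun k _ => integrable_planeWave_mul hbox _, ← integral_const_mul]
    congr 1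
    ext s
    by_cases hs : s ∈ freqBox d R
    · simp only [Set.indicator_of_mem hs, mul_one, sub_eq_add_neg, planeWave_add_right,
        ← Finset.mul_sum]
      ring
    · simp [Set.indicator_of_notMem hs]
  rw [h, fourierEstimator]
  simp only [waveIntegral_indicator_freqBox hR]
  rw [← Finset.mul_sum, ← Complex.ofReal_re (1 / (n * Real.pi ^ d) * _)]
  congr 1
  push_cast
  simp only [PiLp.sub_apply]
  -- The `2ᵈ` from the transform of the cube reduces `(2π)ᵈ` to the `πᵈ` of the estimator.
  rw [mul_pow, mul_inv, mul_inv, ← mul_assoc]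
  field_simp

lemma integrable_norm_pow_mul_indicator {f : EuclideanSpace ℝ (Fin d) → ℂ} (hf : Continuous f)
    (R : ℝ) (k : ℕ) : Integrable fun s => ‖s‖ ^ k * ‖(freqBox d R).indicator f s‖ := by
  have h : (fun s : EuclideanSpace ℝ (Fin d) => ‖s‖ ^ k * ‖(freqBox d R).indicator f s‖) =
      fun s => ‖(freqBox d R).indicator (fun s => ((‖s‖ ^ k : ℝ) : ℂ) * f s) s‖ := by
    ext s
    by_cases hs : s ∈ freqBox d R
    · simp [hs]
    · simp [hs]
  rw [h]
  exact (integrable_indicator_freqBox (by fun_prop) R).norm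

/-- The amplitude has compact support, so all its moments are finite and differentiation under the
integral is allowed to any order. -/
lemma derivArray_fourierEstimator {n i : ℕ} {R : ℝ} (hR : 0 ≤ R)
    (X : Fin n → EuclideanSpace ℝ (Fin d)) (x : EuclideanSpace ℝ (Fin d)) (u : Fin i → Fin d) :
    derivArray i (fourierEstimator R X) Set.univ x u =
      (n : ℝ)⁻¹ * ∑ k, (derivKernel R u (x - X k)).re := by
  have hc : Continuous fun s => ((n * (2 * Real.pi) ^ d : ℝ)⁻¹ : ℂ) *
      ∑ k, planeWave s (-X k) :=
    continuous_const.mul (continuous_finsetSum _ fun k _ => continuous_planeWave_left _)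
  rw [funext (fourierEstimator_eq hR X), derivArray_re_waveIntegral (N := i)
    (fun k _ => integrable_norm_pow_mul_indicator hc R k)
    (integrable_indicator_freqBox hc R).aestronglyMeasurable le_rfl uniqueDiffOn_univ
    (Set.mem_univ x)]
  have h : waveIntegral (fun s => derivSymbol u s * (freqBox d R).indicator (fun s =>
      ((n * (2 * Real.pi) ^ d : ℝ)⁻¹ : ℂ) * ∑ k, planeWave s (-X k)) s) x =
      ((n : ℝ)⁻¹ : ℂ) * ∑ k, derivKernel R u (x - X k) := by
    simp only [waveIntegral, derivKernel]
    rw [← Finset.mul_sum, ← integral_finsetSum _ fun k _ => integrable_planeWave_mul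
      (integrable_indicator_freqBox (continuous_derivSymbol u) R) _, ← integral_const_mul,
      ← integral_const_mul]
    congr 1
    ext s
    by_cases hs : s ∈ freqBox d R
    · simp only [Set.indicator_of_mem hs, sub_eq_add_neg, planeWave_add_right,
        ← Finset.mul_sum, ← Finset.sum_mul]
      push_cast
      rw [mul_inv]
      ring
    · simp [Set.indicator_of_notMem hs]
  rw [h, ← Complex.ofReal_inv, Complex.re_ofReal_mul, Complex.re_sum]

end Box

/-! ### Fourier inversion of the density and its derivatives -/

section Inversion

open scoped FourierTransform

variable {d : ℕ}

lemma continuous_angularFourier {p : EuclideanSpace ℝ (Fin d) → ℝ} (hp : Integrable p) :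
    Continuous (angularFourier p) := by
  have h : angularFourier p = fun s => waveIntegral (fun x => (p x : ℂ)) (-s) :=
    funext (angularFourier_eq_waveIntegral p)
  rw [h]
  exact (continuous_waveIntegral hp.ofReal).comp continuous_neg

lemma fourier_eq_angularFourier (p : EuclideanSpace ℝ (Fin d) → ℝ)
    (v : EuclideanSpace ℝ (Fin d)) :
    𝓕 (fun x => (p x : ℂ)) v = angularFourier p ((2 * Real.pi) • v) := by
  rw [Real.fourier_eq', angularFourier]
  congr 1
  ext x
  rw [smul_eq_mul]
  congr 2
  rw [PiLp.inner_apply]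
  simp only [PiLp.smul_apply, smul_eq_mul, RCLike.inner_apply, conj_trivial]
  push_cast
  rw [Finset.mul_sum, Finset.mul_sum, Finset.sum_mul]
  refine Finset.sum_congr rfl fun j _ => ?_
  ring

/-- Fourier inversion at continuity points, in angular frequency. -/
lemma waveIntegral_angularFourier {p : EuclideanSpace ℝ (Fin d) → ℝ} (hp : Integrable p)
    (hi : Integrable (angularFourier p)) {x : EuclideanSpace ℝ (Fin d)}
    (hx : ContinuousAt p x) :
    waveIntegral (fun s => (((2 * Real.pi) ^ d)⁻¹ : ℝ) * angularFourier p s) x = p x := by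
  have hpi : (2 * Real.pi) ≠ 0 := by positivity
  have hF : 𝓕 (fun x => (p x : ℂ)) = fun v => angularFourier p ((2 * Real.pi) • v) :=
    funext (fourier_eq_angularFourier p)
  have hFi : Integrable (𝓕 (fun x => (p x : ℂ))) := by
    rw [hF]
    exact hi.comp_smul hpi
  have hP : Integrable fun x => (p x : ℂ) := hp.ofReal
  have h := hP.fourierInv_fourier_eq hFi
    (Complex.continuous_ofReal.continuousAt.comp hx)
  rw [← h, Real.fourierInv_eq', hF]
  -- The substitution `s = 2π v` passes to angular frequency; its Jacobian is the factor `(2π)⁻ᵈ`.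
  have hs := Measure.integral_comp_smul volume
    (fun s : EuclideanSpace ℝ (Fin d) => planeWave s x * angularFourier p s) (2 * Real.pi)
  rw [finrank_euclideanSpace_fin, abs_of_pos (by positivity), Complex.real_smul,
    ← integral_const_mul] at hs
  have hw : waveIntegral (fun s => (((2 * Real.pi) ^ d)⁻¹ : ℝ) * angularFourier p s) x =
      ∫ s, (((2 * Real.pi) ^ d)⁻¹ : ℝ) * (planeWave s x * angularFourier p s) := by
    rw [waveIntegral]
    congr 1
    ext s
    push_cast
    ring
  rw [hw, ← hs]
  congr 1
  ext v
  rw [smul_eq_mul, planeWave]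
  congr 2
  rw [PiLp.inner_apply]
  simp only [PiLp.smul_apply, smul_eq_mul, RCLike.inner_apply, conj_trivial]
  push_cast
  rw [Finset.mul_sum, Finset.mul_sum, Finset.sum_mul]
  refine Finset.sum_congr rfl fun j _ => ?_
  ring

/-- On a regular domain, a smooth density agrees with its Fourier inversion. -/
lemma eqOn_re_waveIntegral {r : ℕ} {S : Set (EuclideanSpace ℝ (Fin d))}
    {p : EuclideanSpace ℝ (Fin d) → ℝ} (hS : S ⊆ closure (interior S)) (hp : Integrable p)
    (hr : ContDiffOn ℝ r p S) (hi : Integrable (angularFourier p)) :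
    Set.EqOn p (fun x =>
      (waveIntegral (fun s => (((2 * Real.pi) ^ d)⁻¹ : ℝ) * angularFourier p s) x).re) S := by
  -- Continuity of `p` on `S` gives continuity in the whole space only at interior points, so
  -- inversion is applied there and then extended to `S` by density of the interior.
  have hint : Set.EqOn p (fun x =>
      (waveIntegral (fun s => (((2 * Real.pi) ^ d)⁻¹ : ℝ) * angularFourier p s) x).re)
      (interior S) := by
    intro x hx
    simp only
    rw [waveIntegral_angularFourier hp hi
      (hr.continuousOn.continuousAt (mem_interior_iff_mem_nhds.1 hx)), Complex.ofReal_re]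
  have hc : Continuous fun x =>
      (waveIntegral (fun s => (((2 * Real.pi) ^ d)⁻¹ : ℝ) * angularFourier p s) x).re :=
    Complex.continuous_re.comp (continuous_waveIntegral (hi.const_mul _))
  exact hint.of_subset_closure hr.continuousOn hc.continuousOn interior_subset hS

/-- On `S` the density coincides with a wave integral smooth on the whole space, and unique
differentiability lets derivatives within `S` be computed from that extension, boundary points
included. -/
lemma derivArray_density {r i : ℕ} {S : Set (EuclideanSpace ℝ (Fin d))}
    {p : EuclideanSpace ℝ (Fin d) → ℝ} (hS : IsRegularDomain S) (hp : Integrable p)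
    (hr : ContDiffOn ℝ r p S)
    (hi : ∀ k ≤ i, Integrable fun s => ‖s‖ ^ k * ‖angularFourier p s‖)
    {x : EuclideanSpace ℝ (Fin d)} (hx : x ∈ S) (u : Fin i → Fin d) :
    derivArray i p S x u = ((((2 * Real.pi) ^ d)⁻¹ : ℝ) *
      waveIntegral (fun s => derivSymbol u s * angularFourier p s) x).re := by
  have hcont := continuous_angularFourier hp
  have hi0 : Integrable (angularFourier p) :=
    (integrable_norm_iff hcont.aestronglyMeasurable).1 (by simpa using hi 0 (Nat.zero_le _))
  have h := derivArray_re_waveIntegral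
    (g := fun s => ((((2 * Real.pi) ^ d)⁻¹ : ℝ) : ℂ) * angularFourier p s) (N := i)
    (fun k hk => ((hi k hk).const_mul ‖((((2 * Real.pi) ^ d)⁻¹ : ℝ) : ℂ)‖).congr
      (Filter.Eventually.of_forall fun s => by simp only [norm_mul]; ring))
    (continuous_const.mul hcont).aestronglyMeasurable le_rfl hS.uniqueDiffOn hx u
  rw [derivArray, iteratedFDerivWithin_congr
    (eqOn_re_waveIntegral hS.subset_closure_interior hp hr hi0) hx]
  refine h.trans ?_
  congr 1
  rw [waveIntegral, waveIntegral, ← integral_const_mul]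
  congr 1
  ext s
  ring

end Inversion

/-! ### Kernel moments by Parseval, and integrals outside the cube -/

section Moments

variable {d : ℕ}

lemma waveIntegral_neg (G : EuclideanSpace ℝ (Fin d) → ℂ) (z : EuclideanSpace ℝ (Fin d)) :
    waveIntegral G (-z) = waveIntegral (fun s => G (-s)) z := by
  rw [waveIntegral, waveIntegral, ← integral_neg_eq_self]
  simp only [planeWave_neg_neg]

lemma integral_waveIntegral_neg_mul {G h : EuclideanSpace ℝ (Fin d) → ℂ} (hG : Integrable G)
    (hh : Integrable h) :
    ∫ z, waveIntegral G (-z) * h z = ∫ s, G s * waveIntegral h (-s) := by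
  simp only [waveIntegral_neg G]
  rw [integral_waveIntegral_mul hG.comp_neg hh, ← integral_neg_eq_self]
  simp only [neg_neg]

lemma conj_waveIntegral_neg (G : EuclideanSpace ℝ (Fin d) → ℂ)
    (z : EuclideanSpace ℝ (Fin d)) :
    (starRingEnd ℂ) (waveIntegral G (-z)) = waveIntegral (fun s => (starRingEnd ℂ) (G s)) z := by
  rw [waveIntegral, waveIntegral, ← integral_conj]
  simp only [map_mul, conj_planeWave, planeWave_neg_neg]

lemma waveIntegral_planeWave_mul (h : EuclideanSpace ℝ (Fin d) → ℂ)
    (a y : EuclideanSpace ℝ (Fin d)) :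
    waveIntegral (fun z => planeWave z a * h z) y = waveIntegral h (y + a) := by
  rw [waveIntegral, waveIntegral]
  simp only [planeWave_add_right, mul_assoc]

lemma integrable_waveIntegral_mul {G h : EuclideanSpace ℝ (Fin d) → ℂ} (hG : Integrable G)
    (hh : Integrable h) : Integrable fun z => waveIntegral G z * h z :=
  hh.bdd_mul (continuous_waveIntegral hG).aestronglyMeasurable
    (Filter.Eventually.of_forall (norm_waveIntegral_le G))

/-- The second moment of a wave integral under an integrable weight is controlled by the `L¹` norm
of the Fourier transform of the weight. -/
lemma integral_norm_waveIntegral_sq_mul_le {G : EuclideanSpace ℝ (Fin d) → ℂ}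
    (hG : Integrable G) {B : ℝ} (hB : ∀ s, ‖G s‖ ≤ B) {p : EuclideanSpace ℝ (Fin d) → ℝ}
    (hp : Integrable p) (hi : Integrable (angularFourier p)) :
    ∫ z, ‖waveIntegral G (-z)‖ ^ 2 * p z ≤
      (∫ s, ‖G s‖) * (B * ∫ s, ‖angularFourier p s‖) := by
  have hP : Integrable fun x => (p x : ℂ) := hp.ofReal
  have hGc : Integrable fun s => (starRingEnd ℂ) (G s) :=
    hG.congr' (g := fun s => (starRingEnd ℂ) (G s))
      (Complex.continuous_conj.comp_aestronglyMeasurable hG.1)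
      (Filter.Eventually.of_forall fun s => by simp)
  -- `h` is the conjugate of `waveIntegral G (-z)` times `p`, so the second moment is the integral
  -- of `waveIntegral G (-z) * h z`.
  set h : EuclideanSpace ℝ (Fin d) → ℂ := fun z =>
    waveIntegral (fun s => (starRingEnd ℂ) (G s)) z * (p z : ℂ) with hdef
  have hh : Integrable h := integrable_waveIntegral_mul hGc hP
  have hwave : ∀ s, ‖waveIntegral h (-s)‖ ≤ B * ∫ t, ‖angularFourier p t‖ := by
    intro s
    -- The transform of a product is a convolution. Bounding `G` by `B` and translating leaves the
    -- `L¹` norm of the transform of `p`; no pointwise bound on `p` is needed.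
    have h1 : waveIntegral h (-s) = ∫ t, (starRingEnd ℂ) (G t) * angularFourier p (s - t) := by
      have h2 := integral_waveIntegral_mul hGc (integrable_planeWave_mul hP (-s))
      have h3 : waveIntegral h (-s) = ∫ z, waveIntegral (fun s => (starRingEnd ℂ) (G s)) z *
          (planeWave z (-s) * (p z : ℂ)) := by
        rw [waveIntegral]
        congr 1
        ext z
        rw [hdef]
        ring
      rw [h3, h2]
      simp only [waveIntegral_planeWave_mul, angularFourier_eq_waveIntegral, sub_eq_add_neg,
        neg_add_rev, neg_neg]
    rw [h1, ← integral_const_mul, ← integral_sub_left_eq_self (fun t => B *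
      ‖angularFourier p t‖) volume s]
    refine norm_integral_le_of_norm_le ((hi.norm.comp_sub_left s).const_mul B)
      (Filter.Eventually.of_forall fun t => ?_)
    rw [norm_mul, RCLike.norm_conj]
    exact mul_le_mul_of_nonneg_right (hB t) (norm_nonneg _)
  have hsq : ((∫ z, ‖waveIntegral G (-z)‖ ^ 2 * p z : ℝ) : ℂ) =
      ∫ s, G s * waveIntegral h (-s) := by
    rw [← integral_waveIntegral_neg_mul hG hh, ← integral_complex_ofReal]
    congr 1
    ext z
    rw [hdef]
    simp only [← conj_waveIntegral_neg, ← mul_assoc, Complex.mul_conj, Complex.normSq_eq_norm_sq]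
    push_cast
    rfl
  calc ∫ z, ‖waveIntegral G (-z)‖ ^ 2 * p z
      ≤ ‖((∫ z, ‖waveIntegral G (-z)‖ ^ 2 * p z : ℝ) : ℂ)‖ := by
        rw [Complex.norm_real]
        exact le_abs_self _
    _ ≤ _ := by
        rw [hsq, ← integral_mul_const]
        refine norm_integral_le_of_norm_le (hG.norm.mul_const _)
          (Filter.Eventually.of_forall fun s => ?_)
        rw [norm_mul]
        exact mul_le_mul_of_nonneg_left (hwave s) (norm_nonneg _)

lemma derivKernel_sub {i : ℕ} (R : ℝ) (u : Fin i → Fin d) (x z : EuclideanSpace ℝ (Fin d)) :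
    derivKernel R u (x - z) = waveIntegral (fun s => (((2 * Real.pi) ^ d)⁻¹ : ℝ) *
      (planeWave s x * (freqBox d R).indicator (derivSymbol u) s)) (-z) := by
  rw [derivKernel, waveIntegral, waveIntegral, ← integral_const_mul]
  congr 1
  ext s
  rw [sub_eq_add_neg, planeWave_add_right]
  ring

lemma integrable_derivKernel_amplitude {i : ℕ} (R : ℝ) (u : Fin i → Fin d)
    (x : EuclideanSpace ℝ (Fin d)) :
    Integrable fun s => ((((2 * Real.pi) ^ d)⁻¹ : ℝ) : ℂ) *
      (planeWave s x * (freqBox d R).indicator (derivSymbol u) s) :=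
  (integrable_planeWave_mul (integrable_indicator_freqBox (continuous_derivSymbol u) R)
    x).const_mul _

lemma integral_derivKernel_mul {i : ℕ} (R : ℝ) (u : Fin i → Fin d)
    (x : EuclideanSpace ℝ (Fin d)) {p : EuclideanSpace ℝ (Fin d) → ℝ} (hp : Integrable p) :
    ∫ z, derivKernel R u (x - z) * (p z : ℂ) = (((2 * Real.pi) ^ d)⁻¹ : ℝ) *
      waveIntegral ((freqBox d R).indicator fun s => derivSymbol u s * angularFourier p s) x := by
  have hP : Integrable fun z => (p z : ℂ) := hp.ofReal
  simp only [derivKernel_sub]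
  rw [integral_waveIntegral_neg_mul (integrable_derivKernel_amplitude R u x) hP,
    waveIntegral, ← integral_const_mul]
  congr 1
  ext s
  rw [← angularFourier_eq_waveIntegral]
  by_cases hs : s ∈ freqBox d R
  · simp only [Set.indicator_of_mem hs]
    ring
  · simp [Set.indicator_of_notMem hs]

lemma integral_norm_derivKernel_sq_mul_le {i : ℕ} {R : ℝ} (hR : 0 ≤ R) (u : Fin i → Fin d)
    (x : EuclideanSpace ℝ (Fin d)) {p : EuclideanSpace ℝ (Fin d) → ℝ} (hp : Integrable p)
    (hi : Integrable (angularFourier p)) :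
    ∫ z, ‖derivKernel R u (x - z)‖ ^ 2 * p z ≤
      2 ^ d * (∫ s, ‖angularFourier p s‖) * R ^ (2 * i + d) := by
  have hc1 : ((2 * Real.pi) ^ d)⁻¹ ≤ 1 :=
    inv_le_one_of_one_le₀ (one_le_pow₀ (by nlinarith [Real.pi_gt_three]))
  have hc0 : 0 ≤ ((2 * Real.pi) ^ d)⁻¹ := by positivity
  have hn : ∀ s, ‖((((2 * Real.pi) ^ d)⁻¹ : ℝ) : ℂ) *
      (planeWave s x * (freqBox d R).indicator (derivSymbol u) s)‖ ≤
      (freqBox d R).indicator (fun _ => R ^ i) s := by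
    intro s
    rw [norm_mul, norm_mul, norm_planeWave, one_mul, Complex.norm_real, Real.norm_eq_abs,
      abs_of_nonneg hc0]
    exact (mul_le_of_le_one_left (norm_nonneg _) hc1).trans (norm_indicator_derivSymbol_le u s)
  have hind : ∀ s, (freqBox d R).indicator (fun _ => R ^ i) s ≤ R ^ i := fun s =>
    Set.indicator_le_self' (fun _ _ => by positivity) s
  have hvol : ∫ s, (freqBox d R).indicator (fun _ => R ^ i) s = (2 * R) ^ d * R ^ i := by
    rw [integral_indicator (measurableSet_freqBox R), setIntegral_const, volume_real_freqBox hR,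
      smul_eq_mul]
  have hint : Integrable ((freqBox d R).indicator fun _ => R ^ i) :=
    (integrable_indicator_iff (measurableSet_freqBox R)).2
      (continuous_const.continuousOn.integrableOn_compact (isCompact_freqBox R))
  have hI : 0 ≤ ∫ s, ‖angularFourier p s‖ := integral_nonneg fun _ => norm_nonneg _
  simp only [derivKernel_sub]
  refine (integral_norm_waveIntegral_sq_mul_le (integrable_derivKernel_amplitude R u x)
    (fun s => (hn s).trans (hind s)) hp hi).trans ?_
  -- The first factor bounds the `L¹` norm of the amplitude, the second `R ^ i` its supremum;
  -- `(2π)⁻ᵈ ≤ 1` has been discarded.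
  calc _ ≤ ((2 * R) ^ d * R ^ i) * (R ^ i * ∫ s, ‖angularFourier p s‖) := by
        refine mul_le_mul_of_nonneg_right ?_ (by positivity)
        rw [← hvol]
        exact integral_mono (integrable_derivKernel_amplitude R u x).norm hint hn
    _ = _ := by ring

/-- Amplitudes outside a cube, for dominating functions of product form. -/
lemma integral_compl_freqBox_prod_le {w : ℝ → ℝ} (hw0 : ∀ t, 0 ≤ w t) (hw : Integrable w)
    (R : ℝ) :
    ∫ s in (freqBox d R)ᶜ, ∏ j, w (s j) ≤
      d * (∫ t, w t) ^ (d - 1) * ∫ t in {t : ℝ | R < |t|}, w t := by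
  classical
  have hm : MeasurableSet {t : ℝ | R < |t|} := measurableSet_lt measurable_const measurable_norm
  -- `v j` truncates `w` to `R < |t|` in coordinate `j` alone. The `d` resulting products dominate
  -- the integrand off the cube. For `d = 0` the sum is empty, so the truncated `d - 1` is harmless.
  set v : Fin d → Fin d → ℝ → ℝ := fun j =>
    Function.update (fun _ => w) j ({t : ℝ | R < |t|}.indicator w) with hv
  have hvi : ∀ j k, Integrable (v j k) := by
    intro j k
    by_cases h : k = j
    · subst h
      simpa [hv] using hw.indicator hm
    · simpa [hv, h] using hw
  have hv0 : ∀ j k t, 0 ≤ v j k t := by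
    intro j k t
    by_cases h : k = j
    · subst h
      simpa [hv] using Set.indicator_nonneg (fun t _ => hw0 t) t
    · simpa [hv, h] using hw0 t
  have hprod : ∀ j, ∫ s : EuclideanSpace ℝ (Fin d), ∏ k, v j k (s k) =
      (∫ t in {t : ℝ | R < |t|}, w t) * (∫ t, w t) ^ (d - 1) := by
    intro j
    rw [integral_prod_coord_real, ← Finset.mul_prod_erase _ _ (Finset.mem_univ j)]
    congr 1
    · simp [hv, integral_indicator hm]
    · rw [Finset.prod_congr rfl (g := fun _ => ∫ t, w t) fun k hk => by
        simp [hv, Finset.ne_of_mem_erase hk]]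
      simp
  have hle : ∀ s : EuclideanSpace ℝ (Fin d), (freqBox d R)ᶜ.indicator (fun s => ∏ j, w (s j)) s ≤
      ∑ j, ∏ k, v j k (s k) := by
    intro s
    by_cases hs : s ∈ freqBox d R
    · rw [Set.indicator_of_notMem (by simpa using hs)]
      exact Finset.sum_nonneg fun j _ => Finset.prod_nonneg fun k _ => hv0 j k _
    · rw [Set.indicator_of_mem (by simpa using hs)]
      obtain ⟨j, hj⟩ : ∃ j, s j ∉ Set.Icc (-R) R := by simpa [freqBox] using hs
      have hj' : s j ∈ {t : ℝ | R < |t|} := by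
        by_contra hcon
        exact hj (abs_le.1 (not_lt.1 hcon))
      refine le_trans (le_of_eq ?_) (Finset.single_le_sum (f := fun j => ∏ k, v j k (s k))
        (fun j _ => Finset.prod_nonneg fun k _ => hv0 j k _) (Finset.mem_univ j))
      refine Finset.prod_congr rfl fun k _ => ?_
      by_cases h : k = j
      · subst h
        simp only [hv, Function.update_self, Set.indicator_of_mem hj']
      · simp [hv, h]
  rw [← integral_indicator (measurableSet_freqBox R).compl]
  calc _ ≤ ∫ s : EuclideanSpace ℝ (Fin d), ∑ j, ∏ k, v j k (s k) :=
        integral_mono ((integrable_prod_coord_real fun _ => hw).indicator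
          (measurableSet_freqBox R).compl)
          (integrable_finsetSum _ fun j _ => integrable_prod_coord_real (hvi j)) hle
    _ = _ := by
        rw [integral_finsetSum _ fun j _ => integrable_prod_coord_real (hvi j)]
        simp only [hprod, Finset.sum_const, Finset.card_univ, Fintype.card_fin, nsmul_eq_mul]
        ring

end Moments

/-! ### Mean and variance of the differentiated estimator -/

section Estimator

variable {d n : ℕ} {Ω : Type*} [MeasurableSpace Ω] {P : Measure Ω}
  {X : Fin n → Ω → EuclideanSpace ℝ (Fin d)} {p : EuclideanSpace ℝ (Fin d) → ℝ}

lemma IsIIDSample.integral_comp {F : Type*} [NormedAddCommGroup F] [NormedSpace ℝ F]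
    (hX : IsIIDSample P X p) (hp : IsProbDensity p) {f : EuclideanSpace ℝ (Fin d) → F}
    (hf : StronglyMeasurable f) (k : Fin n) :
    ∫ ω, f (X k ω) ∂P = ∫ z, p z • f z := by
  rw [← integral_map (hX.measurable k).aemeasurable hf.aestronglyMeasurable, hX.law k,
    integral_withDensity_eq_integral_toReal_smul₀ hp.integrable.1.aemeasurable.ennreal_ofReal
      (Filter.Eventually.of_forall fun _ => ENNReal.ofReal_lt_top)]
  simp only [ENNReal.toReal_ofReal (hp.nonneg _)]

lemma continuous_derivKernel_re_sub {i : ℕ} (R : ℝ) (u : Fin i → Fin d)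
    (x : EuclideanSpace ℝ (Fin d)) : Continuous fun z => (derivKernel R u (x - z)).re :=
  Complex.continuous_re.comp
    ((continuous_derivKernel R u).comp (continuous_const.sub continuous_id))

lemma IsIIDSample.memLp_derivKernel [IsProbabilityMeasure P] (hX : IsIIDSample P X p) {i : ℕ}
    (R : ℝ) (u : Fin i → Fin d) (x : EuclideanSpace ℝ (Fin d)) (k : Fin n) :
    MemLp (fun ω => (derivKernel R u (x - X k ω)).re) 2 P := by
  obtain ⟨B, hB⟩ := exists_norm_derivKernel_le R u
  exact MemLp.of_bound
    ((continuous_derivKernel_re_sub R u x).measurable.comp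
      (hX.measurable k)).aestronglyMeasurable B
    (Filter.Eventually.of_forall fun ω => (Complex.abs_re_le_norm _).trans (hB _))

omit [MeasurableSpace Ω] in
lemma estimatorDeriv_eq {i : ℕ} {R : ℝ} (hR : 0 ≤ R) (x : EuclideanSpace ℝ (Fin d))
    (u : Fin i → Fin d) :
    (fun ω => estimatorDeriv R X i x ω u) =
      fun ω => (n : ℝ)⁻¹ * (∑ k, fun ω => (derivKernel R u (x - X k ω)).re) ω := by
  ext ω
  rw [estimatorDeriv, derivArray_fourierEstimator hR, Finset.sum_apply]

lemma IsIIDSample.memLp_estimatorDeriv [IsProbabilityMeasure P] (hX : IsIIDSample P X p) {i : ℕ}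
    {R : ℝ} (hR : 0 ≤ R) (x : EuclideanSpace ℝ (Fin d)) (u : Fin i → Fin d) :
    MemLp (fun ω => estimatorDeriv R X i x ω u) 2 P := by
  rw [estimatorDeriv_eq hR]
  exact (memLp_finsetSum' _ fun k _ => hX.memLp_derivKernel R u x k).const_mul _

lemma IsIIDSample.meanDeriv_eq [IsProbabilityMeasure P] (hX : IsIIDSample P X p)
    (hp : IsProbDensity p) (hn : 0 < n) {i : ℕ} {R : ℝ} (hR : 0 ≤ R)
    (x : EuclideanSpace ℝ (Fin d)) (u : Fin i → Fin d) :
    meanDeriv P R X i x u = ((((2 * Real.pi) ^ d)⁻¹ : ℝ) *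
      waveIntegral ((freqBox d R).indicator fun s => derivSymbol u s * angularFourier p s)
        x).re := by
  have hn' : (n : ℝ) ≠ 0 := by exact_mod_cast hn.ne'
  have hP : Integrable fun z => (p z : ℂ) := hp.integrable.ofReal
  obtain ⟨B, hB⟩ := exists_norm_derivKernel_le R u
  have hK : Integrable fun z => derivKernel R u (x - z) * (p z : ℂ) :=
    hP.bdd_mul ((continuous_derivKernel R u).comp
      (continuous_const.sub continuous_id)).aestronglyMeasurable
      (Filter.Eventually.of_forall fun z => hB _)
  have hk : ∀ k, ∫ ω, (derivKernel R u (x - X k ω)).re ∂P = ((((2 * Real.pi) ^ d)⁻¹ : ℝ) *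
      waveIntegral ((freqBox d R).indicator fun s => derivSymbol u s * angularFourier p s)
        x).re := by
    intro k
    rw [hX.integral_comp hp (continuous_derivKernel_re_sub R u x).stronglyMeasurable k,
      ← integral_derivKernel_mul R u x hp.integrable]
    refine Eq.trans ?_ (integral_re hK)
    congr 1
    ext z
    simp [mul_comm]
  rw [meanDeriv, estimatorDeriv_eq hR, integral_const_mul]
  simp only [Finset.sum_apply]
  rw [integral_finsetSum _ fun k _ => (hX.memLp_derivKernel R u x k).integrable one_le_two]
  simp only [hk, Finset.sum_const, Finset.card_univ, Fintype.card_fin, nsmul_eq_mul]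
  field_simp

/-- Independence makes the variances add, and the prefactor `n⁻²` leaves `1/n`. Each variance is at
most the second moment of the real part of the kernel, hence of its modulus. -/
lemma IsIIDSample.variance_estimatorDeriv_le [IsProbabilityMeasure P] (hX : IsIIDSample P X p)
    (hp : IsProbDensity p) (hi : Integrable (angularFourier p)) (hn : 0 < n) {i : ℕ} {R : ℝ}
    (hR : 0 ≤ R) (x : EuclideanSpace ℝ (Fin d)) (u : Fin i → Fin d) :
    variance (fun ω => estimatorDeriv R X i x ω u) P ≤
      2 ^ d * (∫ s, ‖angularFourier p s‖) * (R ^ (2 * i + d) / n) := by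
  have hn' : (0 : ℝ) < n := by exact_mod_cast hn
  have hvar : ∀ k, variance (fun ω => (derivKernel R u (x - X k ω)).re) P ≤
      2 ^ d * (∫ s, ‖angularFourier p s‖) * R ^ (2 * i + d) := by
    intro k
    have hc := continuous_derivKernel_re_sub R u x
    refine (variance_le_expectation_sq (hX.memLp_derivKernel R u x k).1).trans ?_
    refine le_trans (le_of_eq (hX.integral_comp hp (f := fun z =>
      (derivKernel R u (x - z)).re ^ 2) (hc.pow 2).stronglyMeasurable k)) ?_
    refine le_trans ?_ (integral_norm_derivKernel_sq_mul_le hR u x hp.integrable hi)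
    obtain ⟨B, hB⟩ := exists_norm_derivKernel_le R u
    refine integral_mono_of_nonneg (Filter.Eventually.of_forall fun z =>
      mul_nonneg (hp.nonneg z) (sq_nonneg _)) ?_ (Filter.Eventually.of_forall fun z => ?_)
    · refine hp.integrable.bdd_mul (c := B ^ 2) (((continuous_derivKernel R u).comp
        (continuous_const.sub continuous_id)).norm.pow 2).aestronglyMeasurable
        (Filter.Eventually.of_forall fun z => ?_)
      rw [Real.norm_eq_abs, abs_of_nonneg (sq_nonneg _)]
      exact pow_le_pow_left₀ (norm_nonneg _) (hB _) 2
    · simp only [smul_eq_mul]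
      rw [mul_comm]
      refine mul_le_mul_of_nonneg_right ?_ (hp.nonneg z)
      rw [← sq_abs]
      exact pow_le_pow_left₀ (abs_nonneg _) (Complex.abs_re_le_norm _) 2
  rw [estimatorDeriv_eq hR, variance_const_mul, IndepFun.variance_sum
    (fun k _ => hX.memLp_derivKernel R u x k) fun k _ l _ hkl =>
      (hX.indep.indepFun hkl).comp (continuous_derivKernel_re_sub R u x).measurable
        (continuous_derivKernel_re_sub R u x).measurable]
  calc _ ≤ ((n : ℝ)⁻¹) ^ 2 * ∑ _k : Fin n,
        2 ^ d * (∫ s, ‖angularFourier p s‖) * R ^ (2 * i + d) :=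
        mul_le_mul_of_nonneg_left (Finset.sum_le_sum fun k _ => hvar k) (sq_nonneg _)
    _ = _ := by
        simp only [Finset.sum_const, Finset.card_univ, Fintype.card_fin, nsmul_eq_mul]
        field_simp

lemma IsIIDSample.derivVariance_le [IsProbabilityMeasure P] (hX : IsIIDSample P X p)
    (hp : IsProbDensity p) (hi : Integrable (angularFourier p)) (hn : 0 < n) {i : ℕ} {R : ℝ}
    (hR : 0 ≤ R) (x : EuclideanSpace ℝ (Fin d)) :
    derivVariance P R X i x ≤
      d ^ i * (2 ^ d * ∫ s, ‖angularFourier p s‖) * (R ^ (2 * i + d) / n) := by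
  have hm := fun u : Fin i → Fin d => hX.memLp_estimatorDeriv hR x u
  have h : derivVariance P R X i x =
      ∑ u, variance (fun ω => estimatorDeriv R X i x ω u) P := by
    have hsq : ∀ u, Integrable
        (fun ω => (estimatorDeriv R X i x ω u - meanDeriv P R X i x u) ^ 2) P := fun u =>
      ((hm u).sub (memLp_const (meanDeriv P R X i x u))).integrable_sq
    rw [derivVariance, integral_finsetSum _ fun u _ => hsq u]
    exact Finset.sum_congr rfl fun u _ => (variance_eq_integral (hm u).1.aemeasurable).symm
  rw [h]
  refine (Finset.sum_le_sum fun u _ =>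
    hX.variance_estimatorDeriv_le hp hi hn hR x u).trans_eq ?_
  -- The array has `d ^ i` entries, all with the same variance bound.
  simp only [Finset.sum_const, Finset.card_univ, Fintype.card_pi, Fintype.card_fin,
    Finset.prod_const, nsmul_eq_mul]
  push_cast
  ring

/-- The two error bounds for a density whose Fourier transform is dominated by a product. -/
theorem estimator_bounds [IsProbabilityMeasure P] {r i : ℕ} {φ : ℝ → ℝ} (hφ0 : ∀ t, 0 ≤ φ t)
    (hφ : ∀ k ≤ r, Integrable fun t => (1 + |t|) ^ k * φ t) {c : ℝ}
    (hdec : ∀ s, ‖angularFourier p s‖ ≤ c * ∏ j, φ (s j))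
    {S : Set (EuclideanSpace ℝ (Fin d))} (hS : IsRegularDomain S) (hp : IsProbDensity p)
    (hr : ContDiffOn ℝ r p S) (hX : IsIIDSample P X p) (hn : 0 < n) {R : ℝ} (hR : 0 ≤ R)
    (hir : i ≤ r) {x : EuclideanSpace ℝ (Fin d)} (hx : x ∈ S) :
    (∀ u, MemLp (fun ω => estimatorDeriv R X i x ω u) 2 P) ∧
    maxBias P R X p S i x ≤ |c| * (d * (∫ t, (1 + |t|) ^ i * φ t) ^ (d - 1)) *
      ∫ t in {t : ℝ | R < |t|}, (1 + |t|) ^ i * φ t ∧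
    derivVariance P R X i x ≤ d ^ i * (2 ^ d * (|c| * (∫ t, φ t) ^ d)) *
      (R ^ (2 * i + d) / n) := by
  -- With `|c|` the bounds are nonnegative without any sign condition on `c`.
  have hdec' : ∀ s, ‖angularFourier p s‖ ≤ |c| * ∏ j, φ (s j) := fun s =>
    (hdec s).trans (mul_le_mul_of_nonneg_right (le_abs_self c)
      (Finset.prod_nonneg fun j _ => hφ0 _))
  have hcont := continuous_angularFourier hp.integrable
  have hφint : Integrable φ := by simpa using hφ 0 (Nat.zero_le _)
  have hφd : Integrable fun s : EuclideanSpace ℝ (Fin d) => |c| * ∏ j, φ (s j) :=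
    (integrable_prod_coord_real fun _ => hφint).const_mul _
  have hi : Integrable (angularFourier p) :=
    hφd.mono' hcont.aestronglyMeasurable (Filter.Eventually.of_forall hdec')
  have hwint : ∀ k ≤ r, Integrable fun s : EuclideanSpace ℝ (Fin d) =>
      |c| * ∏ j, (1 + |s j|) ^ k * φ (s j) := fun k hk =>
    (integrable_prod_coord_real fun _ => hφ k hk).const_mul _
  have hmom : ∀ k ≤ i, Integrable fun s => ‖s‖ ^ k * ‖angularFourier p s‖ := by
    intro k hk
    refine (hwint k (hk.trans hir)).mono' (by fun_prop)
      (Filter.Eventually.of_forall fun s => ?_)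
    rw [Real.norm_eq_abs, abs_of_nonneg (by positivity), Finset.prod_mul_distrib,
      Finset.prod_pow, mul_left_comm]
    exact mul_le_mul (pow_le_pow_left₀ (norm_nonneg _) (norm_le_prod_one_add s) k) (hdec' s)
      (norm_nonneg _) (pow_nonneg (Finset.prod_nonneg fun j _ => by positivity) _)
  have hdom : ∀ (u : Fin i → Fin d) s, ‖derivSymbol u s * angularFourier p s‖ ≤
      |c| * ∏ j, (1 + |s j|) ^ i * φ (s j) := by
    intro u s
    rw [norm_mul, Finset.prod_mul_distrib, mul_left_comm]
    exact mul_le_mul (norm_derivSymbol_le u s) (hdec' s) (norm_nonneg _)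
      (Finset.prod_nonneg fun j _ => by positivity)
  refine ⟨fun u => hX.memLp_estimatorDeriv hR x u, ?_, ?_⟩
  · have hw0 : ∀ t : ℝ, 0 ≤ (1 + |t|) ^ i * φ t := fun t => mul_nonneg (by positivity) (hφ0 t)
    have hT : 0 ≤ ∫ t in {t : ℝ | R < |t|}, (1 + |t|) ^ i * φ t :=
      integral_nonneg hw0
    have hW : 0 ≤ ∫ t, (1 + |t|) ^ i * φ t := integral_nonneg hw0
    rw [maxBias, pi_norm_le_iff_of_nonneg (by positivity)]
    intro u
    have hDi : Integrable fun s => derivSymbol u s * angularFourier p s :=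
      (hwint i hir).mono' ((continuous_derivSymbol u).mul hcont).aestronglyMeasurable
        (Filter.Eventually.of_forall (hdom u))
    have hc1 : ((2 * Real.pi) ^ d)⁻¹ ≤ 1 :=
      inv_le_one_of_one_le₀ (one_le_pow₀ (by nlinarith [Real.pi_gt_three]))
    have hc0 : 0 ≤ ((2 * Real.pi) ^ d)⁻¹ := by positivity
    -- Up to the factor `(2π)⁻ᵈ`, the bias is exactly the part of the inversion integral outside the
    -- cube.
    have hdiff : waveIntegral ((freqBox d R).indicator fun s =>
          derivSymbol u s * angularFourier p s) x -
        waveIntegral (fun s => derivSymbol u s * angularFourier p s) x =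
        -waveIntegral ((freqBox d R)ᶜ.indicator fun s =>
          derivSymbol u s * angularFourier p s) x := by
      simp only [waveIntegral]
      rw [← integral_sub (integrable_planeWave_mul
        (hDi.indicator (measurableSet_freqBox R)) x) (integrable_planeWave_mul hDi x),
        ← integral_neg]
      congr 1
      ext s
      by_cases hs : s ∈ freqBox d R
      · simp [hs]
      · simp [hs]
    rw [Pi.sub_apply, hX.meanDeriv_eq hp hn hR, derivArray_density hS hp.integrable hr hmom hx,
      ← Complex.sub_re, ← mul_sub, hdiff]
    calc _ ≤ ‖((((2 * Real.pi) ^ d)⁻¹ : ℝ) : ℂ) * -waveIntegral ((freqBox d R)ᶜ.indicator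
            fun s => derivSymbol u s * angularFourier p s) x‖ := Complex.abs_re_le_norm _
      _ ≤ ‖waveIntegral ((freqBox d R)ᶜ.indicator
            fun s => derivSymbol u s * angularFourier p s) x‖ := by
          rw [norm_mul, norm_neg, Complex.norm_real, Real.norm_eq_abs, abs_of_nonneg hc0]
          exact mul_le_of_le_one_left (norm_nonneg _) hc1
      _ ≤ ∫ s, (freqBox d R)ᶜ.indicator
            (fun s => |c| * ∏ j, (1 + |s j|) ^ i * φ (s j)) s := by
          refine (norm_waveIntegral_le _ _).trans (integral_mono
            (hDi.indicator (measurableSet_freqBox R).compl).norm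
            ((hwint i hir).indicator (measurableSet_freqBox R).compl) fun s => ?_)
          simp only [norm_indicator_eq_indicator_norm]
          exact Set.indicator_le_indicator (hdom u s)
      _ ≤ _ := by
          rw [integral_indicator (measurableSet_freqBox R).compl, integral_const_mul, mul_assoc]
          exact mul_le_mul_of_nonneg_left
            (integral_compl_freqBox_prod_le hw0 (hφ i hir) R) (abs_nonneg c)
  · refine (hX.derivVariance_le hp hi hn hR x).trans ?_
    have h1 : ∫ s, ‖angularFourier p s‖ ≤ |c| * (∫ t, φ t) ^ d := by
      refine (integral_mono hi.norm hφd hdec').trans_eq ?_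
      rw [integral_const_mul, integral_prod_coord_real]
      simp
    gcongr

end Estimator

/-! ### One-dimensional integrability and tail estimates -/

section Tails

open Filter Topology Set

lemma integrable_comp_abs_of_integrableOn_Ioi {f : ℝ → ℝ} (hf : IntegrableOn f (Ioi 0)) :
    Integrable fun t => f |t| := by
  have hpos : IntegrableOn (fun t => f |t|) (Ioi 0) :=
    hf.congr_fun (fun t ht => by rw [abs_of_pos (mem_Ioi.1 ht)]) measurableSet_Ioi
  have hneg : IntegrableOn (fun t => f |t|) (Iio 0) := by
    have h := (Measure.measurePreserving_neg (volume : Measure ℝ)).integrableOn_comp_preimage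
      (Homeomorph.neg ℝ).measurableEmbedding (f := fun t => f |t|) (s := Ioi 0)
    have h' := h.2 hpos
    simpa [Function.comp_def] using h'
  rw [← integrableOn_univ, ← Iic_union_Ioi (a := (0 : ℝ))]
  exact ((integrableOn_Iic_iff_integrableOn_Iio (by simp)).2 hneg).union hpos

lemma setIntegral_lt_abs {R : ℝ} (hR : 0 ≤ R) (f : ℝ → ℝ) :
    ∫ t in {t : ℝ | R < |t|}, f |t| = 2 * ∫ t in Ioi R, f t := by
  have hm : MeasurableSet {t : ℝ | R < |t|} := measurableSet_lt measurable_const measurable_norm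
  have h := integral_comp_abs (f := (Ioi R).indicator f)
  rw [setIntegral_indicator measurableSet_Ioi, Ioi_inter_Ioi, sup_eq_right.2 hR] at h
  rw [← h, ← integral_indicator hm]
  rfl

/-- Since `1 + t` is at most `2` or `2t` according to whether `t ≤ 1`, `(1 + t)^β ≤ 2^β (1 + t^β)`.
-/
lemma one_add_pow_div_le {β t : ℝ} (hβ : 0 ≤ β) (k : ℕ) (ht : 0 ≤ t) :
    (1 + t) ^ k * (1 / (1 + t ^ β)) ≤ 2 ^ β * (1 + t) ^ (-(β - k)) := by
  have h1 : 0 < 1 + t := by linarith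
  have hmax : (1 + t) ^ β ≤ 2 ^ β * (1 + t ^ β) := by
    have htb : 0 ≤ t ^ β := Real.rpow_nonneg ht β
    have h2 : (0 : ℝ) ≤ 2 ^ β := by positivity
    rcases le_total t 1 with h | h
    · calc (1 + t) ^ β ≤ 2 ^ β := Real.rpow_le_rpow h1.le (by linarith) hβ
        _ ≤ _ := le_mul_of_one_le_right h2 (by linarith)
    · calc (1 + t) ^ β ≤ (2 * t) ^ β := Real.rpow_le_rpow h1.le (by linarith) hβ
        _ = 2 ^ β * t ^ β := Real.mul_rpow zero_le_two ht
        _ ≤ _ := mul_le_mul_of_nonneg_left (by linarith) h2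
  have hp : 0 < 1 + t ^ β := by positivity
  rw [neg_sub, Real.rpow_sub h1, Real.rpow_natCast, mul_one_div, mul_div_assoc', div_le_div_iff₀ hp
    (Real.rpow_pos_of_pos h1 β)]
  calc (1 + t) ^ k * (1 + t) ^ β ≤ (1 + t) ^ k * (2 ^ β * (1 + t ^ β)) := by gcongr
    _ = _ := by ring

lemma integrable_one_add_abs_pow_div {β : ℝ} {k : ℕ} (h : 1 + (k : ℝ) < β) :
    Integrable fun t : ℝ => (1 + |t|) ^ k * (1 / (1 + |t| ^ β)) := by
  have hk : (0 : ℝ) ≤ k := Nat.cast_nonneg k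
  have hdom : Integrable fun t : ℝ => 2 ^ β * (1 + ‖t‖) ^ (-(β - k)) :=
    (integrable_one_add_norm (by simp; linarith)).const_mul _
  refine hdom.mono' (by fun_prop) (Eventually.of_forall fun t => ?_)
  rw [Real.norm_eq_abs, Real.norm_eq_abs, abs_of_nonneg (by positivity)]
  exact one_add_pow_div_le (by linarith) k (abs_nonneg t)

lemma setIntegral_one_add_abs_pow_div_le {β R : ℝ} {k : ℕ} (h : 1 + (k : ℝ) < β) (hR : 0 < R) :
    ∫ t in {t : ℝ | R < |t|}, (1 + |t|) ^ k * (1 / (1 + |t| ^ β)) ≤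
      2 * (2 ^ β / (β - (k + 1))) / R ^ (β - (k + 1)) := by
  have hk : (0 : ℝ) ≤ k := Nat.cast_nonneg k
  rw [setIntegral_lt_abs hR.le fun t => (1 + t) ^ k * (1 / (1 + t ^ β)), mul_div_assoc]
  refine mul_le_mul_of_nonneg_left ?_ zero_le_two
  have hlt : -(β - k) < -1 := by linarith
  calc _ ≤ ∫ t in Ioi R, 2 ^ β * t ^ (-(β - k)) := by
        refine integral_mono_of_nonneg ?_ ((integrableOn_Ioi_rpow_of_lt hlt hR).const_mul _) ?_
        · filter_upwards [ae_restrict_mem measurableSet_Ioi] with t ht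
          have ht0 : 0 < t := hR.trans ht
          simp only [Pi.zero_apply]
          positivity
        · filter_upwards [ae_restrict_mem measurableSet_Ioi] with t ht
          have ht0 : 0 < t := hR.trans ht
          refine (one_add_pow_div_le (by linarith) k ht0.le).trans
            (mul_le_mul_of_nonneg_left ?_ (by positivity))
          -- The exponent is negative, so replacing `1 + t` by `t` only enlarges the integrand; this
          -- is why every `R > 0` is allowed.
          exact Real.rpow_le_rpow_of_nonpos ht0 (by linarith) (by linarith)
    _ = _ := by
        rw [integral_const_mul, integral_Ioi_rpow_of_lt hlt hR,
          show -(β - k) + 1 = -(β - (k + 1)) by ring, Real.rpow_neg hR.le, neg_div_neg_eq]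
        field_simp

lemma one_add_pow_le {t : ℝ} (ht : 0 ≤ t) (k : ℕ) : (1 + t) ^ k ≤ 2 ^ k * (1 + t ^ k) := by
  rcases le_total t 1 with h | h
  · calc (1 + t) ^ k ≤ 2 ^ k := pow_le_pow_left₀ (by linarith) (by linarith) k
      _ ≤ _ := le_mul_of_one_le_right (by positivity) (by linarith [pow_nonneg ht k])
  · calc (1 + t) ^ k ≤ (2 * t) ^ k := pow_le_pow_left₀ (by linarith) (by linarith) k
      _ = 2 ^ k * t ^ k := mul_pow _ _ _
      _ ≤ _ := by gcongr; linarith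

lemma integrable_one_add_abs_pow_mul_exp {α C₁ : ℝ} (hα : 0 < α) (hC : 0 < C₁) (k : ℕ) :
    Integrable fun t : ℝ => (1 + |t|) ^ k * Real.exp (-C₁ * |t| ^ α) := by
  refine integrable_comp_abs_of_integrableOn_Ioi
    (f := fun t => (1 + t) ^ k * Real.exp (-C₁ * t ^ α)) ?_
  have h0 := integrableOn_rpow_mul_exp_neg_mul_rpow (s := 0) (by norm_num) hα hC
  have hk := integrableOn_rpow_mul_exp_neg_mul_rpow (s := (k : ℝ))
    (by linarith [Nat.cast_nonneg (α := ℝ) k]) hα hC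
  refine ((h0.add hk).const_mul (2 ^ k)).mono' (by fun_prop) ?_
  filter_upwards [ae_restrict_mem measurableSet_Ioi] with t ht
  have ht0 : 0 < t := ht
  rw [Real.norm_eq_abs, abs_of_nonneg (by positivity)]
  simp only [Pi.add_apply, Real.rpow_zero, Real.rpow_natCast, ← add_mul, ← mul_assoc]
  exact mul_le_mul_of_nonneg_right (one_add_pow_le ht0.le k) (Real.exp_pos _).le

/-- The tail of an upper incomplete Gamma integral, beyond the point where its leading term
dominates. -/
lemma setIntegral_Ioi_pow_mul_exp_le {α C₁ R : ℝ} {k : ℕ} (hα : 0 < α) (hC : 0 < C₁) (hR : 1 ≤ R)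
    (hRα : 2 * (k + 1) ≤ C₁ * α * R ^ α) :
    IntegrableOn (fun t : ℝ => t ^ k * Real.exp (-C₁ * t ^ α)) (Ioi R) ∧
    ∫ t in Ioi R, t ^ k * Real.exp (-C₁ * t ^ α) ≤
      2 / (C₁ * α) * (R ^ (1 + (k : ℝ) - α) * Real.exp (-C₁ * R ^ α)) := by
  have hCα : 0 < C₁ * α := mul_pos hC hα
  set a : ℝ := 1 + (k : ℝ) - α with ha
  -- Twice the leading term of the antiderivative found by parts. Doubling leaves room for the
  -- correction term: `g'` still dominates the integrand once `2(k + 1) ≤ C₁ α t^α`.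
  set g : ℝ → ℝ := fun t => -(2 / (C₁ * α) * (t ^ a * Real.exp (-C₁ * t ^ α))) with hg
  set g' : ℝ → ℝ := fun t => -(2 / (C₁ * α) * (a * t ^ (a - 1) * Real.exp (-C₁ * t ^ α) +
    t ^ a * (Real.exp (-C₁ * t ^ α) * (-C₁ * (α * t ^ (α - 1)))))) with hg'
  have hderiv : ∀ t ∈ Ici R, HasDerivAt g (g' t) t := by
    intro t ht
    have ht0 : t ≠ 0 := by linarith [mem_Ici.1 ht]
    exact (((Real.hasDerivAt_rpow_const (Or.inl ht0)).mul
      (((Real.hasDerivAt_rpow_const (Or.inl ht0)).const_mul (-C₁)).exp)).const_mul _).neg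
  have hle : ∀ t ∈ Ioi R, t ^ k * Real.exp (-C₁ * t ^ α) ≤ g' t := by
    intro t ht
    have hRt : R < t := ht
    have ht0 : 0 < t := by linarith
    have h1 : t ^ a * t ^ (α - 1) = t ^ k := by
      rw [← Real.rpow_add ht0, ← Real.rpow_natCast]
      congr 1
      rw [ha]
      ring
    have h2 : t ^ (a - 1) * t ^ α = t ^ k := by
      rw [← Real.rpow_add ht0, ← Real.rpow_natCast]
      congr 1
      rw [ha]
      ring
    have h3 : R ^ α ≤ t ^ α := Real.rpow_le_rpow (by linarith) hRt.le hα.le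
    have h4 : 2 * ((k : ℝ) + 1) ≤ C₁ * α * t ^ α :=
      hRα.trans (mul_le_mul_of_nonneg_left h3 hCα.le)
    -- The sign of `a` is irrelevant: only `a ≤ k + 1` and `t^(a-1) t^α = t^k` enter the next bound.
    have h5 : 0 ≤ t ^ (a - 1) := Real.rpow_nonneg ht0.le _
    have h6 : a * t ^ (a - 1) ≤ C₁ * α / 2 * t ^ k := by
      rw [← h2]
      nlinarith [mul_le_mul_of_nonneg_left h4 h5]
    have h7 : g' t = 2 / (C₁ * α) * ((C₁ * α * t ^ k - a * t ^ (a - 1)) *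
        Real.exp (-C₁ * t ^ α)) := by
      rw [hg', ← h1]
      ring
    rw [h7, ← mul_assoc]
    refine mul_le_mul_of_nonneg_right ?_ (Real.exp_pos _).le
    rw [div_mul_eq_mul_div, le_div_iff₀ hCα]
    linarith
  have hnn : ∀ t ∈ Ioi R, 0 ≤ t ^ k * Real.exp (-C₁ * t ^ α) := fun t ht => by
    have ht0 : 0 < t := by linarith [mem_Ioi.1 ht]
    positivity
  have hlim : Tendsto g atTop (𝓝 0) := by
    have h := ((tendsto_rpow_mul_exp_neg_mul_atTop_nhds_zero (a / α) C₁ hC).comp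
      (tendsto_rpow_atTop hα)).const_mul (2 / (C₁ * α))
    rw [mul_zero] at h
    rw [← neg_zero]
    refine (h.congr' ?_).neg
    filter_upwards [eventually_gt_atTop 0] with t ht
    simp only [Function.comp_apply]
    rw [← Real.rpow_mul ht.le, mul_div_cancel₀ _ hα.ne']
  have hpos : ∀ t ∈ Ioi R, 0 ≤ g' t := fun t ht => (hnn t ht).trans (hle t ht)
  -- A nonnegative derivative of a function with a limit is integrable, so both integrability and
  -- the value `-g R` follow.
  have hint := integrableOn_Ioi_deriv_of_nonneg' hderiv hpos hlim
  have hval := integral_Ioi_of_hasDerivAt_of_nonneg' hderiv hpos hlim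
  have hint' : IntegrableOn (fun t : ℝ => t ^ k * Real.exp (-C₁ * t ^ α)) (Ioi R) := by
    refine hint.mono' (by fun_prop) ?_
    filter_upwards [ae_restrict_mem measurableSet_Ioi] with t ht
    rw [Real.norm_eq_abs, abs_of_nonneg (hnn t ht)]
    exact hle t ht
  refine ⟨hint', (setIntegral_mono_on hint' hint measurableSet_Ioi hle).trans_eq ?_⟩
  rw [hval, hg]
  ring

/-- Beyond `R ≥ 1` one has `1 + t ≤ 2t`, which costs `2 ^ k`; the outer `2` counts the two
half-lines. Raising the exponent to its maximum with `0` is also allowed because `R ≥ 1`. -/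
lemma setIntegral_one_add_abs_pow_mul_exp_le {α C₁ R : ℝ} {k : ℕ} (hα : 0 < α) (hC : 0 < C₁)
    (hR : 1 ≤ R) (hRα : 2 * (k + 1) ≤ C₁ * α * R ^ α) :
    ∫ t in {t : ℝ | R < |t|}, (1 + |t|) ^ k * Real.exp (-C₁ * |t| ^ α) ≤
      2 * (2 ^ k * (2 / (C₁ * α))) *
        (R ^ max (1 + (k : ℝ) - α) 0 * Real.exp (-C₁ * R ^ α)) := by
  rw [setIntegral_lt_abs (by linarith) fun t => (1 + t) ^ k * Real.exp (-C₁ * t ^ α)]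
  obtain ⟨hint, hle⟩ := setIntegral_Ioi_pow_mul_exp_le hα hC hR hRα
  have hmain : ∫ t in Ioi R, (1 + t) ^ k * Real.exp (-C₁ * t ^ α) ≤
      2 ^ k * ∫ t in Ioi R, t ^ k * Real.exp (-C₁ * t ^ α) := by
    rw [← integral_const_mul]
    refine integral_mono_of_nonneg ?_ (hint.const_mul _) ?_
    · filter_upwards [ae_restrict_mem measurableSet_Ioi] with t ht
      have ht0 : 0 < t := by linarith [mem_Ioi.1 ht]
      simp only [Pi.zero_apply]
      positivity
    · filter_upwards [ae_restrict_mem measurableSet_Ioi] with t ht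
      have ht1 : R < t := ht
      rw [← mul_assoc, ← mul_pow]
      refine mul_le_mul_of_nonneg_right ?_ (Real.exp_pos _).le
      exact pow_le_pow_left₀ (by linarith) (by linarith) k
  have hpow : R ^ (1 + (k : ℝ) - α) ≤ R ^ max (1 + (k : ℝ) - α) 0 :=
    Real.rpow_le_rpow_of_exponent_le hR (le_max_left _ _)
  have hfin : ∫ t in Ioi R, (1 + t) ^ k * Real.exp (-C₁ * t ^ α) ≤
      2 ^ k * (2 / (C₁ * α) * (R ^ max (1 + (k : ℝ) - α) 0 * Real.exp (-C₁ * R ^ α))) := by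
    refine hmain.trans (mul_le_mul_of_nonneg_left (hle.trans ?_) (by positivity))
    gcongr
  linarith

end Tails

theorem theorem3 (d r : ℕ) (hr : 1 ≤ r) :
    (∀ α C C₁ : ℝ, 0 < α → 0 < C₁ →
      ∃ (C' : ℝ) (Cb Cv : ℕ → ℝ), 0 < C' ∧
        ∀ (S : Set (EuclideanSpace ℝ (Fin d))) (p : EuclideanSpace ℝ (Fin d) → ℝ),
          IsRegularDomain S → IsProbDensity p → MemCr r S p → UpperSupersmooth p α C C₁ →
        ∀ (Ω : Type*) [MeasurableSpace Ω] (P : Measure Ω) [IsProbabilityMeasure P]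
          (n : ℕ) (X : Fin n → Ω → EuclideanSpace ℝ (Fin d)),
          0 < n → IsIIDSample P X p →
        ∀ R : ℝ, C' ≤ R → ∀ i : ℕ, 1 ≤ i → i ≤ r → ∀ x ∈ S,
          (∀ u, MemLp (fun ω => estimatorDeriv R X i x ω u) 2 P) ∧
          maxBias P R X p S i x
            ≤ Cb i * R ^ (max (1 + (i : ℝ) - α) 0) * Real.exp (-C₁ * R ^ α) ∧
          derivVariance P R X i x ≤ Cv i * (R ^ (2 * i + d) / n)) ∧
    (∀ β c : ℝ, 1 + (r : ℝ) < β →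
      ∃ (cb Cv : ℕ → ℝ),
        ∀ (S : Set (EuclideanSpace ℝ (Fin d))) (p : EuclideanSpace ℝ (Fin d) → ℝ),
          IsRegularDomain S → IsProbDensity p → MemCr r S p → UpperOrdinarySmooth p β c →
        ∀ (Ω : Type*) [MeasurableSpace Ω] (P : Measure Ω) [IsProbabilityMeasure P]
          (n : ℕ) (X : Fin n → Ω → EuclideanSpace ℝ (Fin d)),
          0 < n → IsIIDSample P X p →
        ∀ R : ℝ, 0 < R → ∀ i : ℕ, 1 ≤ i → i ≤ r → ∀ x ∈ S,
          (∀ u, MemLp (fun ω => estimatorDeriv R X i x ω u) 2 P) ∧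
          maxBias P R X p S i x ≤ cb i / R ^ (β - ((i : ℝ) + 1)) ∧
          derivVariance P R X i x ≤ Cv i * (R ^ (2 * i + d) / n)) := by
  constructor
  · intro α C C₁ hα hC₁
    have hCα : 0 < C₁ * α := mul_pos hC₁ hα
    -- The threshold ensures `R ≥ 1` and `2(r + 1) ≤ C₁ α R^α`, so the tail estimate applies to all
    -- `i ≤ r` at once.
    refine ⟨max 1 ((2 * (r + 1) / (C₁ * α)) ^ α⁻¹), fun i => |C| * (d *
      (∫ t : ℝ, (1 + |t|) ^ i * Real.exp (-C₁ * |t| ^ α)) ^ (d - 1)) *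
      (2 * (2 ^ i * (2 / (C₁ * α)))), fun i => d ^ i * (2 ^ d * (|C| *
      (∫ t : ℝ, Real.exp (-C₁ * |t| ^ α)) ^ d)), lt_max_of_lt_left one_pos, ?_⟩
    intro S p hS hp hmem hsm Ω _ P _ n X hn hX R hR i _ hir x hx
    have hR1 : 1 ≤ R := (le_max_left _ _).trans hR
    have hRα : 2 * ((i : ℝ) + 1) ≤ C₁ * α * R ^ α := by
      have h1 : 2 * ((r : ℝ) + 1) / (C₁ * α) ≤ R ^ α := by
        have h2 := Real.rpow_le_rpow (by positivity) ((le_max_right _ _).trans hR) hα.le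
        rwa [Real.rpow_inv_rpow (by positivity) hα.ne'] at h2
      rw [div_le_iff₀' hCα] at h1
      have h3 : (i : ℝ) ≤ r := by exact_mod_cast hir
      linarith
    obtain ⟨h1, h2, h3⟩ := estimator_bounds (φ := fun t => Real.exp (-C₁ * |t| ^ α))
      (fun t => (Real.exp_pos _).le)
      (fun k _ => integrable_one_add_abs_pow_mul_exp hα hC₁ k) (c := C)
      -- The exponential of the sum factors over coordinates, giving the product form.
      (fun s => by rw [← Real.exp_sum, ← Finset.mul_sum]; exact hsm s)
      hS hp hmem.contDiffOn hX hn (zero_le_one.trans hR1) hir hx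
    refine ⟨h1, h2.trans ?_, h3⟩
    rw [mul_assoc (_ * _), mul_assoc (_ * _)]
    have hI : 0 ≤ ∫ t : ℝ, (1 + |t|) ^ i * Real.exp (-C₁ * |t| ^ α) :=
      integral_nonneg fun t => by positivity
    refine mul_le_mul_of_nonneg_left ?_ (by positivity)
    rw [← mul_assoc]
    exact (setIntegral_one_add_abs_pow_mul_exp_le hα hC₁ hR1 hRα).trans_eq (by ring)
  · intro β c hβ
    refine ⟨fun i => |c| * (d * (∫ t : ℝ, (1 + |t|) ^ i * (1 / (1 + |t| ^ β))) ^ (d - 1)) *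
      (2 * (2 ^ β / (β - (i + 1)))), fun i => d ^ i * (2 ^ d * (|c| *
      (∫ t : ℝ, 1 / (1 + |t| ^ β)) ^ d)), ?_⟩
    intro S p hS hp hmem hsm Ω _ P _ n X hn hX R hR i _ hir x hx
    have hk : ∀ k ≤ r, 1 + (k : ℝ) < β := fun k hk => by
      have h : (k : ℝ) ≤ r := by exact_mod_cast hk
      linarith
    obtain ⟨h1, h2, h3⟩ := estimator_bounds (φ := fun t => 1 / (1 + |t| ^ β))
      (fun t => by positivity)
      (fun k hkr => integrable_one_add_abs_pow_div (hk k hkr)) (c := c) hsm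
      hS hp hmem.contDiffOn hX hn hR.le hir hx
    refine ⟨h1, h2.trans ?_, h3⟩
    have hI : 0 ≤ ∫ t : ℝ, (1 + |t|) ^ i * (1 / (1 + |t| ^ β)) :=
      integral_nonneg fun t => by positivity
    rw [mul_div_assoc]
    exact mul_le_mul_of_nonneg_left (setIntegral_one_add_abs_pow_div_le (hk i hir) hR)
      (by positivity)
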